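/- Let $U$ be a real separable Hilbert space and let $\Lambda:D(\Lambda)\subset U\to U$ be a positive self-adjoint operator with a bounded inverse $\Lambda^{-1}$ of trace class. Let $V'$ be the dual of $V=D(\Lambda^{1/2})$, i.e. the completion of $U$ for the norm $\|x\|_{V'}=\|\Lambda^{-1/2}x\|_U$; extend $\Lambda$ to a self-adjoint operator on $V'$ (with domain $V$), still denoted $\Lambda$, and let $\Lambda^s$ denote its powers on $V'$. Let $\alpha\in[0,1)$ and $\rho>0$ be such that $\rho^2\neq 4\mu^{1-2\alpha}$ for every eigenvalue $\mu$ of $\Lambda$. Put $H=U\times V'$, $\widetilde H=V'\times V'$, $Ga=(0,a)$ for $a\in V'$, and $$\mathcal A_{\alpha,\rho}(z_1,z_2)=(z_2,\,-\Lambda z_1-\rho\Lambda^\alpha z_2)\ \text{ in } H,\qquad \widetilde{\mathcal A}_{\alpha,\rho}(y_1,y_2)=(\Lambda^{1/2}y_2,\,-\Lambda^{1/2}y_1-\rho\Lambda^\alpha y_2)\ \text{ in }\widetilde H,$$ with domains $D(\Lambda)\times D(\Lambda^{\frac12\vee\alpha})$ and $D(\Lambda^{1/2})\times D(\Lambda^{\frac12\vee\alpha})$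 (powers on $V'$). Solutions of $z'=\mathcal A_{\alpha,\rho}z+Gu$, $z(0)=k$ in $H$, and of $y'=\widetilde{\mathcal A}_{\alpha,\rho}y+Gu$, $y(0)=k$ in $\widetilde H$, are mild solutions for the strongly continuous semigroups generated by (the closures of) these operators. For $0<t\le T$ let $$\mathcal E_C(t,k)=\inf\Big\{\int_0^t\|u(s)\|_{V'}^2\,ds:\ u\in L^2(0,T;V'),\ z(0)=k,\ z(t)=0\Big\},$$ and let $\widetilde{\mathcal E}_C(t,k)$ be the analogous infimum for the system in $\widetilde H$ (with $\inf\emptyset=+\infty$). Then there is a constant $C>0$ such that for all $a\in V'$ and all $0<t\le T$, with $k=Ga$, $$\widetilde{\mathcal E}_C(t,k)\le\frac{C\|a\|_{V'}^2}{t},\qquad \widetilde{\mathcal E}_C(t,k)=\mathcal E_C(t,k),\qquad \mathcal E_C(t,k)\le\frac{C\|a\|_{V'}^2}{t}.$$ Moreover, in both systems $Ga$ is steered to $0$ at time $t$ by a control $v\in L^2(0,T;V')$ with $\int_0^t\|v(s)\|^2_{V'}ds\le C\|a\|^2_{V'}/t$ which on $[0,t]$ equals $v_0+v_1'$, where, for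 every eigenvector $e\in V'$ of $\Lambda$ with eigenvalue $\mu$, $$\langle v_0(s),e\rangle_{V'}=-\frac{\lambda^-e^{\lambda^+s}-\lambda^+e^{\lambda^-s}}{\lambda^--\lambda^+}\,\phi_t(s)\,\langle a,e\rangle_{V'},\qquad \langle v_1(s),e\rangle_{V'}=-\frac{-e^{\lambda^+s}+e^{\lambda^-s}}{\lambda^--\lambda^+}\,\phi_t(s)\,\langle a,e\rangle_{V'},$$ with $\lambda^\pm=\frac12\big(-\rho\mu^\alpha\pm\sqrt{\rho^2\mu^{2\alpha}-4\mu}\big)$ and $\phi_t(s)=s^2(t-s)^2\big/\int_0^t r^2(t-r)^2\,dr$. -/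

import Mathlib

open MeasureTheory Filter Topology Set
open scoped ENNReal

noncomputable section

namespace DampedWave

/-! ### Unbounded operators, given by their graphs, and strongly continuous semigroups -/

section Abstract

variable {E : Type*} [NormedAddCommGroup E] [InnerProductSpace ℝ E]
variable {F : Type*} [NormedAddCommGroup F] [InnerProductSpace ℝ F]

/-- A bounded operator on a Hilbert space is of trace class (nuclear) if it is a sum
`∑ ⟪x n, ·⟫ y n` of rank-one operators with `∑ ‖x n‖ ‖y n‖ < ∞`. -/
def IsTraceClass (R : E →L[ℝ] E) : Prop :=
  ∃ x y : ℕ → E, Summable (fun n => ‖x n‖ * ‖y n‖) ∧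
    ∀ z, HasSum (fun n => inner ℝ (x n) z • y n) (R z)

/-- The graph of the power `A ^ s` of a positive self-adjoint operator with graph `A` whose
eigenvectors are complete: `x ∈ D(A ^ s)` and `A ^ s x = y` if and only if, along each
eigenvector `e` with eigenvalue `μ`, the coefficient of `y` is `μ ^ s` times that of `x`. -/
def spectralPower (A : Set (E × E)) (s : ℝ) : Set (E × E) :=
  {p | ∀ (e : E) (μ : ℝ), (e, μ • e) ∈ A → inner ℝ p.2 e = μ ^ s * inner ℝ p.1 e}

/-- `S` restricted to `[0, ∞)` is a strongly continuous semigroup of bounded operators. -/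
structure IsC0Semigroup (S : ℝ → E →L[ℝ] E) : Prop where
  map_zero : S 0 = ContinuousLinearMap.id ℝ E
  map_add : ∀ s t, 0 ≤ s → 0 ≤ t → S (s + t) = (S s).comp (S t)
  tendsto_zero : ∀ x, Tendsto (fun t => S t x) (𝓝[>] 0) (𝓝 x)

/-- The graph of the infinitesimal generator of `S`. -/
def generatorGraph (S : ℝ → E →L[ℝ] E) : Set (E × E) :=
  {p | Tendsto (fun h : ℝ => h⁻¹ • (S h p.1 - p.1)) (𝓝[>] 0) (𝓝 p.2)}

/-- `y` is, on `[0, T]`, the mild solution of `y' = A y + B u`, `y(0) = k`, where the closure of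
the operator with graph `A` generates a strongly continuous semigroup. -/
def IsMildSolution (A : Set (E × E)) (B : F →L[ℝ] E) (T : ℝ) (k : E) (u : ℝ → F)
    (y : ℝ → E) : Prop :=
  ∃ S : ℝ → E →L[ℝ] E, IsC0Semigroup S ∧ generatorGraph S = closure A ∧
    ∀ t ∈ Icc 0 T, y t = S t k + ∫ r in (0 : ℝ)..t, S (t - r) (B (u r))

/-- The control `u ∈ L²(0, T; F)` steers `k` to `0` at time `t` in `y' = A y + B u`. -/
def Steers (A : Set (E × E)) (B : F →L[ℝ] E) (T t : ℝ) (k : E) (u : ℝ → F) : Prop :=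
  MemLp u 2 (volume.restrict (Ioc 0 T)) ∧ ∃ y, IsMildSolution A B T k u y ∧ y t = 0

/-- The minimal energy needed to steer `k` to `0` at time `t` (`∞` if this is impossible). -/
def controlEnergy (A : Set (E × E)) (B : F →L[ℝ] E) (T t : ℝ) (k : E) : ℝ≥0∞ :=
  ⨅ (u : ℝ → F) (_ : Steers A B T t k u), ∫⁻ s in Ioc 0 t, ‖u s‖ₑ ^ 2

end Abstract

/-! ### The operator `Λ` and the space `V'` -/

/-- A positive self-adjoint operator `Λ : D(Λ) ⊂ U → U` together with its bounded inverse. -/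
structure PosOp (U : Type*) [NormedAddCommGroup U] [InnerProductSpace ℝ U] [CompleteSpace U] where
  op : U →ₗ.[ℝ] U
  selfAdjoint : IsSelfAdjoint op
  nonneg : ∀ x : op.domain, 0 ≤ inner ℝ (op x) (x : U)
  inv : U →L[ℝ] U
  inv_mem : ∀ x, inv x ∈ op.domain
  op_inv : ∀ x, op ⟨inv x, inv_mem x⟩ = x
  inv_op : ∀ x : op.domain, inv (op x) = x

variable {U : Type*} [NormedAddCommGroup U] [InnerProductSpace ℝ U] [CompleteSpace U]

namespace PosOp

theorem inv_symm (Λ : PosOp U) (x y : U) : inner ℝ (Λ.inv x) y = inner ℝ x (Λ.inv y) := by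
  have h := LinearPMap.adjoint_isFormalAdjoint (T := Λ.op) Λ.selfAdjoint.dense_domain
  rw [LinearPMap.isSelfAdjoint_def.1 Λ.selfAdjoint] at h
  have := h ⟨Λ.inv x, Λ.inv_mem x⟩ ⟨Λ.inv y, Λ.inv_mem y⟩
  rw [Λ.op_inv, Λ.op_inv] at this
  exact this.symm

theorem inv_nonneg (Λ : PosOp U) (x : U) : 0 ≤ inner ℝ (Λ.inv x) x := by
  have := Λ.nonneg ⟨Λ.inv x, Λ.inv_mem x⟩
  rw [Λ.op_inv] at this
  rwa [real_inner_comm]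

theorem inv_definite (Λ : PosOp U) (x : U) (hx : inner ℝ (Λ.inv x) x = 0) : x = 0 := by
  have key : inner ℝ (Λ.inv x) (Λ.inv x) = 0 := by
    by_contra hne
    set q := inner ℝ (Λ.inv x) (Λ.inv x)
    set r := inner ℝ (Λ.inv (Λ.inv x)) (Λ.inv x)
    have h := Λ.inv_nonneg ((-(r + 1) / (2 * q)) • x + Λ.inv x)
    simp only [map_add, map_smul, inner_add_left, inner_add_right, inner_smul_left,
      inner_smul_right, hx, Λ.inv_symm (Λ.inv x) x] at h
    change 0 ≤ _ * (_ * 0 + q) + (_ * q + r) at h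
    have h2 : (-(r + 1) / (2 * q)) * q = -(r + 1) / 2 := by field_simp
    simp only [conj_trivial, mul_zero, zero_add, h2] at h
    linarith
  have h0 : Λ.inv x = 0 := inner_self_eq_zero.1 key
  have h1 := Λ.op_inv x
  have h2 : (⟨Λ.inv x, Λ.inv_mem x⟩ : Λ.op.domain) = 0 := Subtype.ext h0
  rw [h2, LinearPMap.map_zero] at h1
  exact h1.symm

end PosOp

/-- The space `U`, to be equipped with the inner product `⟪Λ⁻¹ x, y⟫ = ⟪Λ^(-1/2) x, Λ^(-1/2) y⟫`. -/
def PreVDual (_Λ : PosOp U) := U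

instance (Λ : PosOp U) : AddCommGroup (PreVDual Λ) := inferInstanceAs (AddCommGroup U)

instance (Λ : PosOp U) : Module ℝ (PreVDual Λ) := inferInstanceAs (Module ℝ U)

/-- The identity map from `U` to `PreVDual Λ`. -/
def PreVDual.of (Λ : PosOp U) : U →ₗ[ℝ] PreVDual Λ := LinearMap.id

/-- The identity map from `PreVDual Λ` to `U`. -/
def PreVDual.out (Λ : PosOp U) : PreVDual Λ →ₗ[ℝ] U := LinearMap.id

@[reducible]
def PreVDual.core (Λ : PosOp U) : InnerProductSpace.Core ℝ (PreVDual Λ) where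
  inner x y := inner ℝ (Λ.inv (PreVDual.out Λ x)) (PreVDual.out Λ y)
  conj_inner_symm x y := by
    rw [Λ.inv_symm (PreVDual.out Λ y), real_inner_comm, conj_trivial]
  re_inner_nonneg x := Λ.inv_nonneg (PreVDual.out Λ x)
  add_left x y z := by simp [inner_add_left]
  smul_left x y r := by simp [inner_smul_left]
  definite x hx := Λ.inv_definite (PreVDual.out Λ x) hx

instance (Λ : PosOp U) : NormedAddCommGroup (PreVDual Λ) :=
  (PreVDual.core Λ).toNormedAddCommGroup

instance (Λ : PosOp U) : InnerProductSpace ℝ (PreVDual Λ) :=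
  InnerProductSpace.ofCore (PreVDual.core Λ).toCore

/-- `V'`, the dual of `V = D(Λ^(1/2))`, realised as the completion of `U` for the dual norm
`‖x‖ = ‖Λ^(-1/2) x‖`. -/
abbrev VDual (Λ : PosOp U) := UniformSpace.Completion (PreVDual Λ)

/-- The inclusion `U ⊂ V'`. -/
def incl (Λ : PosOp U) : U →ₗ[ℝ] VDual Λ :=
  (UniformSpace.Completion.toComplₗᵢ (𝕜 := ℝ) (E := PreVDual Λ)).toLinearMap.comp (PreVDual.of Λ)

/-- The graph of the extension of `Λ` to a self-adjoint operator on `V'` (with domain `V`): the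
closure in `V' × V'` of the graph of `Λ`. -/
def extGraph (Λ : PosOp U) : Set (VDual Λ × VDual Λ) :=
  closure {p | ∃ x : Λ.op.domain, p = (incl Λ (x : U), incl Λ (Λ.op x))}

/-- The graph of the power `Λ ^ s` on `V'`. -/
def powGraph (Λ : PosOp U) (s : ℝ) : Set (VDual Λ × VDual Λ) := spectralPower (extGraph Λ) s

/-! ### The damped wave operators and the control system -/

/-- The Hilbert space `H = U × V'`. -/
abbrev StateH (Λ : PosOp U) := WithLp 2 (U × VDual Λ)

/-- The Hilbert space `H̃ = V' × V'`. -/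
abbrev StateHt (Λ : PosOp U) := WithLp 2 (VDual Λ × VDual Λ)

/-- `a ↦ (0, a)` from `V'` to `H = U × V'`. -/
def G (Λ : PosOp U) : VDual Λ →L[ℝ] StateH Λ :=
  (WithLp.prodContinuousLinearEquiv 2 ℝ U (VDual Λ)).symm.toContinuousLinearMap.comp
    (ContinuousLinearMap.inr ℝ U (VDual Λ))

/-- `a ↦ (0, a)` from `V'` to `H̃ = V' × V'`. -/
def Gt (Λ : PosOp U) : VDual Λ →L[ℝ] StateHt Λ :=
  (WithLp.prodContinuousLinearEquiv 2 ℝ (VDual Λ) (VDual Λ)).symm.toContinuousLinearMap.comp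
    (ContinuousLinearMap.inr ℝ (VDual Λ) (VDual Λ))

/-- The graph of `(z₁, z₂) ↦ (z₂, -Λ z₁ - ρ Λ^α z₂)` in `H`, with domain all `(z₁, z₂)` such that
`z₁ ∈ D(Λ) = V`, `z₂ ∈ U` and `z₂ ∈ D(Λ^α)`. -/
def waveGraph (Λ : PosOp U) (α ρ : ℝ) : Set (StateH Λ × StateH Λ) :=
  {p | incl Λ p.2.fst = p.1.snd ∧
    ∃ b c : VDual Λ, (incl Λ p.1.fst, b) ∈ extGraph Λ ∧ (p.1.snd, c) ∈ powGraph Λ α ∧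
      p.2.snd = -b - ρ • c}

/-- The graph of `(y₁, y₂) ↦ (Λ^(1/2) y₂, -Λ^(1/2) y₁ - ρ Λ^α y₂)` in `H̃`, with domain all
`(y₁, y₂)` such that `y₁ ∈ D(Λ^(1/2))` and `y₂ ∈ D(Λ^(1/2)) ∩ D(Λ^α)`. -/
def waveGraphT (Λ : PosOp U) (α ρ : ℝ) : Set (StateHt Λ × StateHt Λ) :=
  {p | (p.1.snd, p.2.fst) ∈ powGraph Λ (1 / 2) ∧
    ∃ b c : VDual Λ, (p.1.fst, b) ∈ powGraph Λ (1 / 2) ∧ (p.1.snd, c) ∈ powGraph Λ α ∧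
      p.2.snd = -b - ρ • c}

/-! ### The spectral control -/

/-- The root `λ⁺` of `z² + ρ μ^α z + μ = 0`. -/
def rootP (α ρ μ : ℝ) : ℂ :=
  (-((ρ * μ ^ α : ℝ) : ℂ) + ((ρ ^ 2 * μ ^ (2 * α) - 4 * μ : ℝ) : ℂ) ^ (1 / 2 : ℂ)) / 2

/-- The root `λ⁻` of `z² + ρ μ^α z + μ = 0`. -/
def rootM (α ρ μ : ℝ) : ℂ :=
  (-((ρ * μ ^ α : ℝ) : ℂ) - ((ρ ^ 2 * μ ^ (2 * α) - 4 * μ : ℝ) : ℂ) ^ (1 / 2 : ℂ)) / 2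

/-- `φ_t(s) = s² (t - s)² / ∫₀ᵗ r² (t - r)² dr`. -/
def bump (t s : ℝ) : ℝ := s ^ 2 * (t - s) ^ 2 / ∫ r in (0 : ℝ)..t, r ^ 2 * (t - r) ^ 2

/-- The coefficient at time `s` of the part `v₀` of the control along an eigenvector with
eigenvalue `μ`, relative to that of the state to be steered. -/
def coeffZero (α ρ μ t s : ℝ) : ℂ :=
  -((rootM α ρ μ * Complex.exp (rootP α ρ μ * s) - rootP α ρ μ * Complex.exp (rootM α ρ μ * s)) /
    (rootM α ρ μ - rootP α ρ μ)) * bump t s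

/-- The same for the part `v₁`. -/
def coeffOne (α ρ μ t s : ℝ) : ℂ :=
  -((-Complex.exp (rootP α ρ μ * s) + Complex.exp (rootM α ρ μ * s)) /
    (rootM α ρ μ - rootP α ρ μ)) * bump t s

/-- On `[0, t]`, `v` is the control `v₀ + v₁'` attached to `a`. -/
def IsSpectralControl (Λ : PosOp U) (α ρ t : ℝ) (a : VDual Λ) (v : ℝ → VDual Λ) : Prop :=
  ∀ s ∈ Icc 0 t, ∀ (e : VDual Λ) (μ : ℝ), (e, μ • e) ∈ extGraph Λ →
    ((inner ℝ (v s) e : ℝ) : ℂ) =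
      (coeffZero α ρ μ t s + deriv (coeffOne α ρ μ t) s) * ((inner ℝ a e : ℝ) : ℂ)

end DampedWave

end

/-!
A Hilbert basis of eigenvectors of `Λ` diagonalises every operator in sight: both damped wave
systems become the same block-diagonal system on `ℓ²(ι, ℂ)`, whose block at the eigenvalue `m ^ 2`
is the dissipative operator `x + i y ↦ m y - i (m x + β y)` with `β = ρ m ^ (2 α)`. Hence the same
controls steer `(0, a)` to zero in both systems.

For one block `A` write `exp (r A) i = p r • i + q r • A i`. If `φ` has integral `1` on `[0, t]` and
`q φ` vanishes at the endpoints, an integration by parts shows that the scalar control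
`-p φ - (q φ)'` steers `i` to `0` at time `t`. Dissipativity bounds this control uniformly in `m`
and `β`, by a multiple of `1 / t`, so the modes can be controlled independently of each other at a
total cost of order `‖a‖ ^ 2 / t`.
-/

noncomputable section

namespace DampedWave

/-! ### Change of state space -/

section Transport

variable {E : Type*} [NormedAddCommGroup E] [InnerProductSpace ℝ E]
variable {E' : Type*} [NormedAddCommGroup E'] [InnerProductSpace ℝ E']
variable {F : Type*} [NormedAddCommGroup F] [InnerProductSpace ℝ F]

theorem IsC0Semigroup.conj (J : E ≃L[ℝ] E') {S : ℝ → E →L[ℝ] E} (hS : IsC0Semigroup S) :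
    IsC0Semigroup fun t => J.conjContinuousAlgEquiv (S t) where
  map_zero := by ext x; simp [hS.map_zero]
  map_add s t hs ht := by ext x; simp [hS.map_add s t hs ht]
  tendsto_zero x := by
    simpa [Function.comp_def] using (J.continuous.tendsto _).comp (hS.tendsto_zero (J.symm x))

theorem generatorGraph_conj (J : E ≃L[ℝ] E') (S : ℝ → E →L[ℝ] E) :
    generatorGraph (fun t => J.conjContinuousAlgEquiv (S t)) =
      Prod.map J.symm J.symm ⁻¹' generatorGraph S := by
  ext p
  refine (J.symm.toHomeomorph.isInducing.tendsto_nhds_iff (y := p.2)).trans ?_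
  simp [generatorGraph, Function.comp_def]

theorem closure_preimage_prodMap (J : E ≃L[ℝ] E') (A : Set (E' × E')) :
    closure (Prod.map J J ⁻¹' A) = Prod.map J J ⁻¹' closure A :=
  ((J.toHomeomorph.prodCongr J.toHomeomorph).preimage_closure A).symm

theorem Steers.map (J : E ≃L[ℝ] E') {A : Set (E' × E')} {B : F →L[ℝ] E} {T t : ℝ} {k : E}
    {u : ℝ → F} (h : Steers (Prod.map J J ⁻¹' A) B T t k u) :
    Steers A (J.toContinuousLinearMap ∘L B) T t (J k) u := by
  obtain ⟨hu, y, ⟨S, hS, hgen, hy⟩, hyt⟩ := h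
  refine ⟨hu, J ∘ y, ⟨_, hS.conj J, ?_, fun s hs => ?_⟩, by simp [hyt]⟩
  · rw [generatorGraph_conj, hgen, closure_preimage_prodMap, ← preimage_comp, Prod.map_comp_map]
    simp
  · have hint : J (∫ r in (0 : ℝ)..s, S (s - r) (B (u r))) =
        ∫ r in (0 : ℝ)..s, J (S (s - r) (B (u r))) := by
      simp only [intervalIntegral.intervalIntegral_eq_integral_uIoc, map_smul]
      rw [J.integral_comp_comm]
    simp [hy s hs, hint]

theorem steers_preimage_iff (J : E ≃L[ℝ] E') {A : Set (E' × E')} {B : F →L[ℝ] E} {T t : ℝ}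
    {k : E} {u : ℝ → F} :
    Steers (Prod.map J J ⁻¹' A) B T t k u ↔
      Steers A (J.toContinuousLinearMap ∘L B) T t (J k) u := by
  refine ⟨Steers.map J, fun h => ?_⟩
  have hA : A = Prod.map J.symm J.symm ⁻¹' (Prod.map J J ⁻¹' A) := by
    rw [← preimage_comp, Prod.map_comp_map]
    simp
  rw [hA] at h
  convert h.map J.symm using 1
  · ext x; simp
  · simp

end Transport

/-! ### Block-diagonal semigroups on Hilbert sums -/

section Flow

variable {E : Type*} [NormedAddCommGroup E]

/-- The uniformly continuous group `exp (s A)` generated by a bounded operator `A`. -/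
def flow [NormedSpace ℝ E] (A : E →L[ℝ] E) (s : ℝ) : E →L[ℝ] E := NormedSpace.exp (s • A)

section NormedSpace

variable [NormedSpace ℝ E]

@[simp]
theorem flow_zero (A : E →L[ℝ] E) : flow A 0 = ContinuousLinearMap.id ℝ E := by
  simp [flow, NormedSpace.exp_zero, ContinuousLinearMap.one_def]

variable [CompleteSpace E]

theorem flow_add (A : E →L[ℝ] E) (s t : ℝ) : flow A (s + t) = flow A s ∘L flow A t := by
  let _ : NormedAlgebra ℚ (E →L[ℝ] E) := NormedAlgebra.restrictScalars ℚ ℝ _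
  rw [flow, add_smul, NormedSpace.exp_add_of_commute (((Commute.refl A).smul_left s).smul_right t)]
  rfl

theorem hasDerivAt_flow (A : E →L[ℝ] E) (z : E) (s : ℝ) :
    HasDerivAt (fun r => flow A r z) (flow A s (A z)) s :=
  ((hasDerivAt_exp_smul_const A s).clm_apply (hasDerivAt_const s z)).congr_deriv (by simp [flow])

theorem hasDerivAt_flow' (A : E →L[ℝ] E) (z : E) (s : ℝ) :
    HasDerivAt (fun r => flow A r z) (A (flow A s z)) s :=
  ((hasDerivAt_exp_smul_const' A s).clm_apply (hasDerivAt_const s z)).congr_deriv (by simp [flow])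

theorem flow_map_comm (A : E →L[ℝ] E) (s : ℝ) (z : E) : flow A s (A z) = A (flow A s z) :=
  (hasDerivAt_flow A z s).unique (hasDerivAt_flow' A z s)

theorem continuous_flow_apply (A : E →L[ℝ] E) (z : E) : Continuous fun s => flow A s z :=
  continuous_iff_continuousAt.2 fun s => (hasDerivAt_flow A z s).continuousAt

end NormedSpace

variable [InnerProductSpace ℝ E]

/-- A bounded operator `A` is dissipative if `⟪A z, z⟫ ≤ 0` for all `z`; the norm then decreases
along the trajectories of `z' = A z`. -/
def IsDissipative (A : E →L[ℝ] E) : Prop := ∀ z, inner ℝ (A z) z ≤ 0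

variable [CompleteSpace E] {A : E →L[ℝ] E}

theorem IsDissipative.norm_flow_apply_le (hA : IsDissipative A) {s : ℝ} (hs : 0 ≤ s) (z : E) :
    ‖flow A s z‖ ≤ ‖z‖ := by
  have hanti : Antitone fun r => ‖flow A r z‖ ^ 2 :=
    antitone_of_hasDerivAt_nonpos (fun r => (hasDerivAt_flow' A z r).norm_sq) fun r => by
      rw [real_inner_comm]
      exact mul_nonpos_of_nonneg_of_nonpos zero_le_two (hA _)
  have hsq : ‖flow A s z‖ ^ 2 ≤ ‖z‖ ^ 2 := by simpa using hanti hs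
  exact (sq_le_sq₀ (norm_nonneg _) (norm_nonneg _)).1 hsq

theorem IsDissipative.norm_flow_le (hA : IsDissipative A) {s : ℝ} (hs : 0 ≤ s) : ‖flow A s‖ ≤ 1 :=
  ContinuousLinearMap.opNorm_le_bound _ zero_le_one fun z => by
    simpa using hA.norm_flow_apply_le hs z

theorem IsDissipative.norm_flow_sub_le (hA : IsDissipative A) {s : ℝ} (hs : 0 ≤ s) (z : E) :
    ‖flow A s z - z‖ ≤ s * ‖A z‖ := by
  simpa [mul_comm] using norm_image_sub_le_of_norm_deriv_le_segment'
    (fun r _ => (hasDerivAt_flow A z r).hasDerivWithinAt)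
    (fun r hr => hA.norm_flow_apply_le hr.1 (A z)) s (right_mem_Icc.2 hs)

end Flow

section Lp

variable {ι : Type*} {E : ι → Type*} [∀ i, NormedAddCommGroup (E i)]

theorem tendsto_lp_of_dominated {p : ℝ≥0∞} [Fact (1 ≤ p)] (hp : p ≠ ∞) {X : Type*} {l : Filter X}
    {f : X → lp E p} {x : lp E p} {g : ι → ℝ} (hg : Memℓp g p)
    (hfg : ∀ᶠ n in l, ∀ i, ‖f n i‖ ≤ g i) (hfx : ∀ i, Tendsto (fun n => f n i) l (𝓝 (x i))) :
    Tendsto f l (𝓝 x) := by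
  have hp0 : 0 < p.toReal := ENNReal.toReal_pos (zero_lt_one.trans_le Fact.out).ne' hp
  have hbound : Memℓp (fun i => g i + ‖x i‖) p := hg.add (lp.memℓp x).norm
  have key : Tendsto (fun n => ∑' i, ‖(f n - x) i‖ ^ p.toReal) l (𝓝 (∑' _ : ι, (0 : ℝ))) := by
    refine tendsto_tsum_of_dominated_convergence (hbound.summable hp0) (fun i => ?_) ?_
    · have hi := (((hfx i).sub_const (x i)).norm).rpow_const (p := p.toReal) (Or.inr hp0.le)
      simpa [hp0.ne'] using hi
    · filter_upwards [hfg] with n hn i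
      rw [Real.norm_of_nonneg (by positivity)]
      gcongr
      exact (norm_sub_le _ _).trans ((add_le_add_left (hn i) _).trans (le_abs_self _))
  rw [tendsto_iff_norm_sub_tendsto_zero]
  have hroot := key.rpow_const (p := 1 / p.toReal) (Or.inr (by positivity))
  simpa [lp.norm_eq_tsum_rpow hp0, hp0.ne'] using hroot

theorem memℓp_of_finite_support {f : ∀ i, E i} (hf : {i | f i ≠ 0}.Finite) (p : ℝ≥0∞) :
    Memℓp f p :=
  (memℓp_zero hf).of_exponent_ge zero_le

end Lp

section BlockDiagonal

variable {ι : Type*} {E : ι → Type*} [∀ i, NormedAddCommGroup (E i)]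
  [∀ i, InnerProductSpace ℝ (E i)] (A : ∀ i, E i →L[ℝ] E i)

/-- The graph of the block-diagonal operator `x ↦ (A i (x i))ᵢ` with its maximal domain in the
Hilbert sum of the spaces `E i`. -/
def blockGraph : Set (lp E 2 × lp E 2) := {p | ∀ i, p.2 i = A i (p.1 i)}

theorem isClosed_blockGraph : IsClosed (blockGraph A) := by
  simp only [blockGraph, ofPred_forall]
  refine isClosed_iInter fun i => ?_
  exact isClosed_eq ((lp.evalCLM ℝ E 2 i).continuous.comp continuous_snd)
    (((A i).continuous.comp (lp.evalCLM ℝ E 2 i).continuous).comp continuous_fst)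

theorem closure_eq_blockGraph {𝒜 : Set (lp E 2 × lp E 2)} (h𝒜 : 𝒜 ⊆ blockGraph A)
    (hfin : ∀ p ∈ blockGraph A, {i | p.1 i ≠ 0}.Finite → p ∈ 𝒜) : closure 𝒜 = blockGraph A := by
  classical
  refine subset_antisymm (closure_minimal h𝒜 (isClosed_blockGraph A)) fun p hp => ?_
  let truncate (x : lp E 2) (s : Finset ι) : lp E 2 := ∑ i ∈ s, lp.single 2 i (x i)
  have hlim (x : lp E 2) : Tendsto (truncate x) atTop (𝓝 x) := lp.hasSum_single (by norm_num) x
  have hcoord (x : lp E 2) (s : Finset ι) (i : ι) : truncate x s i = if i ∈ s then x i else 0 := by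
    simp only [truncate, lp.coeFn_sum, Finset.sum_apply, lp.single_apply]
    rw [Finset.sum_pi_single]
  refine mem_closure_of_tendsto ((hlim p.1).prodMk_nhds (hlim p.2))
    (Eventually.of_forall fun s => hfin _ (fun i => ?_) (s.finite_toSet.subset fun i hi => ?_))
  · simp only [hcoord, hp i]
    split_ifs <;> simp
  · exact by_contra fun his => hi ((hcoord p.1 s i).trans (if_neg his))

variable [∀ i, CompleteSpace (E i)] {A}

/-- The semigroup on the Hilbert sum with blocks `exp (t A i)`, extended by the identity to
negative times, where the blocks need not be uniformly bounded. -/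
def blockSemigroup (hA : ∀ i, IsDissipative (A i)) (t : ℝ) : lp E 2 →L[ℝ] lp E 2 :=
  lp.mapCLM 2 (fun i => flow (A i) (max t 0)) zero_le_one
    fun i => (hA i).norm_flow_le (le_max_right t 0)

theorem blockSemigroup_apply (hA : ∀ i, IsDissipative (A i)) {t : ℝ} (ht : 0 ≤ t) (x : lp E 2)
    (i : ι) : blockSemigroup hA t x i = flow (A i) t (x i) := by
  simp [blockSemigroup, max_eq_left ht]

theorem norm_blockSemigroup_le (hA : ∀ i, IsDissipative (A i)) (t : ℝ) :
    ‖blockSemigroup hA t‖ ≤ 1 :=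
  lp.norm_mapCLM_le _ _ zero_le_one _

theorem continuous_blockSemigroup_apply (hA : ∀ i, IsDissipative (A i)) (x : lp E 2) :
    Continuous fun t => blockSemigroup hA t x := by
  refine continuous_iff_continuousAt.2 fun t =>
    tendsto_lp_of_dominated (by norm_num) (lp.memℓp x).norm
      (Eventually.of_forall fun s i => ?_) fun i => ?_
  · exact (hA i).norm_flow_apply_le (le_max_right s 0) (x i)
  · exact ((continuous_flow_apply (A i) (x i)).comp
      (continuous_id.max continuous_const)).tendsto t

theorem continuous_uncurry_blockSemigroup (hA : ∀ i, IsDissipative (A i)) :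
    Continuous fun p : ℝ × lp E 2 => blockSemigroup hA p.1 p.2 :=
  continuous_prod_of_continuous_lipschitzWith' _ 1
    (fun t => (blockSemigroup hA t).lipschitzWith_of_opNorm_le (norm_blockSemigroup_le hA t))
    (continuous_blockSemigroup_apply hA)

theorem isC0Semigroup_blockSemigroup (hA : ∀ i, IsDissipative (A i)) :
    IsC0Semigroup (blockSemigroup hA) where
  map_zero := by ext x i; simp [blockSemigroup_apply]
  map_add s t hs ht := by ext x i; simp [blockSemigroup_apply, hs, ht, add_nonneg, flow_add]
  tendsto_zero x := by
    have h0 : blockSemigroup hA 0 x = x := by ext i; simp [blockSemigroup_apply]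
    simpa [h0] using ((continuous_blockSemigroup_apply hA x).tendsto 0).mono_left
      (nhdsWithin_le_nhds (s := Ioi 0))

theorem generatorGraph_blockSemigroup (hA : ∀ i, IsDissipative (A i)) :
    generatorGraph (blockSemigroup hA) = blockGraph A := by
  ext p
  have hcoord (i : ι) : Tendsto (fun h : ℝ => (h⁻¹ • (blockSemigroup hA h p.1 - p.1)) i) (𝓝[>] 0)
      (𝓝 (A i (p.1 i))) := by
    have hslope := (hasDerivAt_flow (A i) (p.1 i) 0).tendsto_slope_zero_right
    simp only [flow_zero, ContinuousLinearMap.id_apply, zero_add] at hslope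
    refine hslope.congr' ?_
    filter_upwards [self_mem_nhdsWithin] with t ht
    rw [lp.coeFn_smul, Pi.smul_apply, lp.coeFn_sub, Pi.sub_apply,
      blockSemigroup_apply hA (le_of_lt ht)]
  constructor
  · exact fun hp i => tendsto_nhds_unique
      (((lp.evalCLM ℝ E 2 i).continuous.tendsto _).comp hp) (hcoord i)
  · refine fun hp => tendsto_lp_of_dominated (by norm_num) (lp.memℓp p.2).norm ?_ fun i => ?_
    · filter_upwards [self_mem_nhdsWithin] with t ht i
      have ht' : (0 : ℝ) < t := ht
      simp only [lp.coeFn_smul, Pi.smul_apply, lp.coeFn_sub, Pi.sub_apply, hp i,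
        blockSemigroup_apply hA ht'.le, norm_smul, norm_inv, Real.norm_of_nonneg ht'.le]
      rw [inv_mul_le_iff₀ ht']
      exact (hA i).norm_flow_sub_le ht'.le (p.1 i)
    · rw [hp i]
      exact hcoord i

end BlockDiagonal

theorem memLp_restrict_Ioc_of_continuous {F : Type*} [NormedAddCommGroup F] {u : ℝ → F}
    (hu : Continuous u) (p : ℝ≥0∞) (a b : ℝ) : MemLp u p (volume.restrict (Ioc a b)) := by
  obtain ⟨C, hC⟩ := isCompact_Icc.exists_bound_of_continuousOn (s := Icc a b) hu.continuousOn
  exact MemLp.of_bound hu.aestronglyMeasurable C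
    (ae_restrict_of_forall_mem measurableSet_Ioc fun s hs => hC s (Ioc_subset_Icc_self hs))

section BlockControl

variable {ι : Type*} {E : ι → Type*} [∀ i, NormedAddCommGroup (E i)]
  [∀ i, InnerProductSpace ℝ (E i)] [∀ i, CompleteSpace (E i)] {A : ∀ i, E i →L[ℝ] E i}
variable {F : Type*} [NormedAddCommGroup F] [InnerProductSpace ℝ F]

theorem blockSemigroup_duhamel_apply (hA : ∀ i, IsDissipative (A i)) {f : ℝ → lp E 2}
    (hf : Continuous f) {t : ℝ} (ht : 0 ≤ t) (k : lp E 2) (i : ι) :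
    (blockSemigroup hA t k + ∫ r in (0 : ℝ)..t, blockSemigroup hA (t - r) (f r)) i =
      flow (A i) t (k i) + ∫ r in (0 : ℝ)..t, flow (A i) (t - r) (f r i) := by
  have hcont : Continuous fun r => blockSemigroup hA (t - r) (f r) :=
    (continuous_uncurry_blockSemigroup hA).comp ((continuous_const.sub continuous_id).prodMk hf)
  have hcoord : (∫ r in (0 : ℝ)..t, blockSemigroup hA (t - r) (f r)) i =
      ∫ r in (0 : ℝ)..t, blockSemigroup hA (t - r) (f r) i :=
    ((lp.evalCLM ℝ E 2 i).intervalIntegral_comp_comm (hcont.intervalIntegrable 0 t)).symm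
  rw [lp.coeFn_add, Pi.add_apply, hcoord, blockSemigroup_apply hA ht]
  congr 1
  refine intervalIntegral.integral_congr fun r hr => ?_
  rw [uIcc_of_le ht] at hr
  exact blockSemigroup_apply hA (sub_nonneg.2 hr.2) (f r) i

theorem steers_of_integral_flow_eq (hA : ∀ i, IsDissipative (A i)) {𝒜 : Set (lp E 2 × lp E 2)}
    (h𝒜 : closure 𝒜 = blockGraph A) {K : F →L[ℝ] lp E 2} {T t : ℝ} (ht : 0 ≤ t)
    {k : lp E 2} {u : ℝ → F} (hu : Continuous u)
    (hmode : ∀ i, ∫ r in (0 : ℝ)..t, flow (A i) (t - r) (K (u r) i) = -flow (A i) t (k i)) :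
    Steers 𝒜 K T t k u := by
  refine ⟨memLp_restrict_Ioc_of_continuous hu 2 0 T, _,
    ⟨blockSemigroup hA, isC0Semigroup_blockSemigroup hA, ?_, fun _ _ => rfl⟩, ?_⟩
  · rw [generatorGraph_blockSemigroup, h𝒜]
  · ext i
    exact (blockSemigroup_duhamel_apply hA (K.continuous.comp hu) ht k i).trans
      ((congrArg _ (hmode i)).trans (add_neg_cancel _))

end BlockControl

/-! ### Null control of a single mode -/

section Mode

variable {E : Type*} [NormedAddCommGroup E] [NormedSpace ℝ E] [CompleteSpace E]

/-- Since `flow A t b = flow A (t - r) (flow A r b) = p r • flow A (t - r) b +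
q r • flow A (t - r) (A b)`, the integrand is `-φ r • flow A t b` minus the derivative of
`r ↦ (q r * φ r) • flow A (t - r) b`. -/
theorem integral_flow_smul_eq_neg_flow {A : E →L[ℝ] E} {b : E} {p q φ : ℝ → ℝ} {t : ℝ}
    (hflow : ∀ r, flow A r b = p r • b + q r • A b) (hφ : Continuous φ)
    (hqφ : ContDiff ℝ 1 fun r => q r * φ r) (h0 : q 0 * φ 0 = 0) (ht : q t * φ t = 0)
    (hint : ∫ r in (0 : ℝ)..t, φ r = 1) :
    ∫ r in (0 : ℝ)..t, flow A (t - r) ((-(p r * φ r) - deriv (fun r => q r * φ r) r) • b) =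
      -flow A t b := by
  have hsplit (r : ℝ) : flow A t b = p r • flow A (t - r) b + q r • flow A (t - r) (A b) := by
    rw [← map_smul, ← map_smul, ← map_add, ← hflow, ← ContinuousLinearMap.comp_apply, ← flow_add,
      sub_add_cancel]
  have hflow_sub (r : ℝ) :
      HasDerivAt (fun r => flow A (t - r) b) (-flow A (t - r) (A b)) r := by
    simpa [Function.comp_def] using
      (hasDerivAt_flow A b (t - r)).scomp r ((hasDerivAt_id r).const_sub t)
  let D (r : ℝ) : E :=
    (q r * φ r) • -flow A (t - r) (A b) + deriv (fun r => q r * φ r) r • flow A (t - r) b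
  have hderiv (r : ℝ) : HasDerivAt (fun r => (q r * φ r) • flow A (t - r) b) (D r) r :=
    ((hqφ.differentiable one_ne_zero r).hasDerivAt).smul (hflow_sub r)
  have hcont (c : E) : Continuous fun r => flow A (t - r) c :=
    (continuous_flow_apply A c).comp (continuous_const.sub continuous_id)
  have hD : IntervalIntegrable D volume 0 t :=
    ((hqφ.continuous.smul (hcont (A b)).neg).add
      ((hqφ.continuous_deriv le_rfl).smul (hcont b))).intervalIntegrable 0 t
  calc ∫ r in (0 : ℝ)..t, flow A (t - r) ((-(p r * φ r) - deriv (fun r => q r * φ r) r) • b)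
      = ∫ r in (0 : ℝ)..t, (-(φ r • flow A t b) - D r) := by
        refine intervalIntegral.integral_congr fun r _ => ?_
        simp only [map_smul, hsplit r, D]
        module
    _ = -flow A t b := by
        rw [intervalIntegral.integral_sub
          (Continuous.intervalIntegrable (by fun_prop) _ _) hD,
          intervalIntegral.integral_eq_sub_of_hasDerivAt (fun r _ => hderiv r) hD,
          intervalIntegral.integral_neg, intervalIntegral.integral_smul_const, hint, h0, ht]
        simp

end Mode

section Block

/-- The operator `(y₁, y₂) ↦ (m y₂, -m y₁ - β y₂)` on `ℝ² = ℂ`: the damped wave operator on `H̃`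
along an eigenvector of `Λ` with eigenvalue `m²`, where `β` is the damping. -/
def blockOp (m β : ℝ) : ℂ →L[ℝ] ℂ :=
  (m • Complex.imCLM).smulRight 1 - (m • Complex.reCLM + β • Complex.imCLM).smulRight Complex.I

@[simp]
theorem blockOp_re (m β : ℝ) (z : ℂ) : (blockOp m β z).re = m * z.im := by
  simp [blockOp]

@[simp]
theorem blockOp_im (m β : ℝ) (z : ℂ) : (blockOp m β z).im = -m * z.re - β * z.im := by
  simp [blockOp, sub_eq_add_neg, add_comm]

theorem isDissipative_blockOp (m : ℝ) {β : ℝ} (hβ : 0 ≤ β) : IsDissipative (blockOp m β) := by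
  intro z
  simp only [Complex.inner, Complex.mul_re, Complex.conj_re, Complex.conj_im, blockOp_re,
    blockOp_im]
  nlinarith [mul_nonneg hβ (sq_nonneg z.im)]

/-- The solution `d` of `d'' + β d' + m² d = 0` with `d(0) = 0` and `d'(0) = 1`. The first
component of the block system is `m d`, whence the division (so `m ≠ 0` is intended). -/
def position (m β s : ℝ) : ℝ := (flow (blockOp m β) s Complex.I).re / m

/-- The derivative of `position`. -/
def velocity (m β s : ℝ) : ℝ := (flow (blockOp m β) s Complex.I).im

@[simp]
theorem position_zero (m β : ℝ) : position m β 0 = 0 := by simp [position]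

@[simp]
theorem velocity_zero (m β : ℝ) : velocity m β 0 = 1 := by simp [velocity]

theorem hasDerivAt_position {m : ℝ} (hm : m ≠ 0) (β s : ℝ) :
    HasDerivAt (position m β) (velocity m β s) s :=
  ((Complex.reCLM.hasFDerivAt.comp_hasDerivAt s
    (hasDerivAt_flow' (blockOp m β) Complex.I s)).div_const m).congr_deriv
    (by simp [velocity, hm])

theorem hasDerivAt_velocity (m β s : ℝ) :
    HasDerivAt (velocity m β) (-m ^ 2 * position m β s - β * velocity m β s) s := by
  refine (Complex.imCLM.hasFDerivAt.comp_hasDerivAt s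
    (hasDerivAt_flow' (blockOp m β) Complex.I s)).congr_deriv ?_
  simp only [Complex.imCLM_apply, blockOp_im, velocity, position]
  field_simp

theorem continuous_velocity (m β : ℝ) : Continuous (velocity m β) :=
  continuous_iff_continuousAt.2 fun s => (hasDerivAt_velocity m β s).continuousAt

theorem contDiff_position {m : ℝ} (hm : m ≠ 0) (β : ℝ) : ContDiff ℝ 1 (position m β) := by
  refine contDiff_one_iff_deriv.2
    ⟨fun s => (hasDerivAt_position hm β s).differentiableAt, ?_⟩
  rw [funext fun s => (hasDerivAt_position hm β s).deriv]
  exact continuous_velocity m β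

theorem flow_blockOp_I {m : ℝ} (hm : m ≠ 0) (β s : ℝ) :
    flow (blockOp m β) s Complex.I = (velocity m β s + β * position m β s) • Complex.I +
      position m β s • blockOp m β Complex.I := by
  apply Complex.ext <;> simp only [velocity, position, Complex.add_re, Complex.add_im,
    Complex.smul_re, Complex.smul_im, blockOp_re, blockOp_im, Complex.I_re, Complex.I_im,
    smul_eq_mul]
  · field_simp
    ring
  · ring

theorem flow_blockOp_one_re {m : ℝ} (hm : m ≠ 0) (β s : ℝ) :
    (flow (blockOp m β) s 1).re = velocity m β s + β * position m β s := by
  have hI : blockOp m β Complex.I = m • (1 : ℂ) - β • Complex.I := by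
    apply Complex.ext <;> simp
  have hre := congrArg Complex.re (flow_map_comm (blockOp m β) s Complex.I)
  rw [hI, map_sub, map_smul, map_smul, blockOp_re] at hre
  simp only [Complex.sub_re, Complex.real_smul, Complex.re_ofReal_mul] at hre
  simp only [velocity, position]
  field_simp
  linarith

theorem abs_velocity_le (m : ℝ) {β : ℝ} (hβ : 0 ≤ β) {s : ℝ} (hs : 0 ≤ s) :
    |velocity m β s| ≤ 1 :=
  (Complex.abs_im_le_norm _).trans
    (((isDissipative_blockOp m hβ).norm_flow_apply_le hs _).trans (by simp))

theorem abs_velocity_add_le {m β : ℝ} (hm : m ≠ 0) (hβ : 0 ≤ β) {s : ℝ} (hs : 0 ≤ s) :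
    |velocity m β s + β * position m β s| ≤ 1 := by
  rw [← flow_blockOp_one_re hm]
  exact (Complex.abs_re_le_norm _).trans
    (((isDissipative_blockOp m hβ).norm_flow_apply_le hs _).trans (by simp))

theorem abs_position_le {m β : ℝ} (hm : m ≠ 0) (hβ : 0 ≤ β) {s : ℝ} (hs : 0 ≤ s) :
    |position m β s| ≤ s := by
  simpa using norm_image_sub_le_of_norm_deriv_le_segment'
    (fun r _ => (hasDerivAt_position hm β r).hasDerivWithinAt)
    (fun r hr => abs_velocity_le m hβ hr.1) s (right_mem_Icc.2 hs)

end Block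

section Bump

theorem integral_sq_mul_sub_sq (t : ℝ) :
    ∫ r in (0 : ℝ)..t, r ^ 2 * (t - r) ^ 2 = t ^ 5 / 30 := by
  have hderiv (r : ℝ) : HasDerivAt (fun r : ℝ => t ^ 2 * r ^ 3 / 3 - t * r ^ 4 / 2 + r ^ 5 / 5)
      (r ^ 2 * (t - r) ^ 2) r := by
    refine (((((hasDerivAt_pow 3 r).const_mul (t ^ 2)).div_const 3).sub
      (((hasDerivAt_pow 4 r).const_mul t).div_const 2)).add
      ((hasDerivAt_pow 5 r).div_const 5)).congr_deriv ?_
    push_cast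
    ring
  rw [intervalIntegral.integral_eq_sub_of_hasDerivAt (fun r _ => hderiv r)
    (Continuous.intervalIntegrable (by fun_prop) _ _)]
  ring

theorem bump_eq (t s : ℝ) : bump t s = 30 * (s * (t - s)) ^ 2 / t ^ 5 := by
  rw [bump, integral_sq_mul_sub_sq, div_div_eq_mul_div]
  ring

theorem integral_bump {t : ℝ} (ht : t ≠ 0) : ∫ r in (0 : ℝ)..t, bump t r = 1 := by
  simp only [bump, intervalIntegral.integral_div, integral_sq_mul_sub_sq]
  field_simp

theorem contDiff_bump (t : ℝ) : ContDiff ℝ 1 (bump t) := by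
  unfold bump
  fun_prop

theorem hasDerivAt_bump (t s : ℝ) :
    HasDerivAt (bump t) (60 * (s * (t - s) * (t - 2 * s)) / t ^ 5) s := by
  rw [funext (bump_eq t)]
  refine (((((hasDerivAt_id s).mul ((hasDerivAt_id s).const_sub t)).pow 2).const_mul
    30).div_const (t ^ 5)).congr_deriv ?_
  simp only [Pi.mul_apply, id_eq, Nat.cast_ofNat]
  ring

variable {t s : ℝ}

theorem mul_sub_le_sq_div_four (t s : ℝ) : s * (t - s) ≤ t ^ 2 / 4 := by
  linarith [sq_nonneg (t - 2 * s)]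

theorem abs_bump_le (ht : 0 < t) (hs : s ∈ Icc 0 t) : |bump t s| ≤ 2 / t := by
  have hnonneg : 0 ≤ s * (t - s) := mul_nonneg hs.1 (sub_nonneg.2 hs.2)
  calc |bump t s| = 30 * (s * (t - s)) ^ 2 / t ^ 5 := by
        rw [bump_eq, abs_of_nonneg (by positivity)]
    _ ≤ 30 * (t ^ 2 / 4) ^ 2 / t ^ 5 := by
        gcongr
        exact mul_sub_le_sq_div_four t s
    _ = 15 / 8 / t := by field_simp; norm_num
    _ ≤ 2 / t := by gcongr; norm_num

theorem abs_deriv_bump_le (ht : 0 < t) (hs : s ∈ Icc 0 t) : |deriv (bump t) s| ≤ 15 / t ^ 2 := by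
  have hnonneg : 0 ≤ s * (t - s) := mul_nonneg hs.1 (sub_nonneg.2 hs.2)
  have habs : |t - 2 * s| ≤ t := abs_le.2 ⟨by linarith [hs.2], by linarith [hs.1]⟩
  calc |deriv (bump t) s| = 60 * (s * (t - s) * |t - 2 * s|) / t ^ 5 := by
        rw [(hasDerivAt_bump t s).deriv, abs_div, abs_mul, abs_mul, abs_of_nonneg hnonneg,
          abs_of_pos (by positivity : 0 < t ^ 5), abs_of_pos (by norm_num : (0 : ℝ) < 60)]
    _ ≤ 60 * (t ^ 2 / 4 * t) / t ^ 5 := by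
        gcongr
        exact mul_sub_le_sq_div_four t s
    _ = 15 / t ^ 2 := by field_simp; norm_num

end Bump

section ScalarControl

/-- The value at time `s` of the scalar control that steers the block `(m, β)` from `(0, 1)` to
`0` at time `t`. Its two terms are the coefficients of `v₀` and of `v₁'`. -/
def controlCoeff (m β t s : ℝ) : ℝ :=
  -((velocity m β s + β * position m β s) * bump t s) -
    deriv (fun r => position m β r * bump t r) s

variable {m β t s : ℝ}

theorem continuous_controlCoeff (hm : m ≠ 0) (β t : ℝ) : Continuous (controlCoeff m β t) := by
  have hposition := contDiff_position hm β
  have hbump := contDiff_bump t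
  exact (((continuous_velocity m β).add (continuous_const.mul hposition.continuous)).mul
    hbump.continuous).neg.sub ((hposition.mul hbump).continuous_deriv le_rfl)

theorem abs_controlCoeff_le (hm : m ≠ 0) (hβ : 0 ≤ β) (ht : 0 < t) (hs : s ∈ Icc 0 t) :
    |controlCoeff m β t s| ≤ 19 / t := by
  have hderiv : deriv (fun r => position m β r * bump t r) s =
      velocity m β s * bump t s + position m β s * deriv (bump t) s :=
    ((hasDerivAt_position hm β s).mul (hasDerivAt_bump t s).differentiableAt.hasDerivAt).deriv
  calc |controlCoeff m β t s|
      ≤ |velocity m β s + β * position m β s| * |bump t s| +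
        (|velocity m β s| * |bump t s| + |position m β s| * |deriv (bump t) s|) := by
        rw [controlCoeff, hderiv, ← abs_mul, ← abs_mul, ← abs_mul]
        refine (abs_sub _ _).trans ?_
        rw [abs_neg]
        gcongr
        exact abs_add_le _ _
    _ ≤ 1 * (2 / t) + (1 * (2 / t) + t * (15 / t ^ 2)) := by
        gcongr
        exacts [abs_velocity_add_le hm hβ hs.1, abs_bump_le ht hs, abs_velocity_le m hβ hs.1,
          abs_bump_le ht hs, (abs_position_le hm hβ hs.1).trans hs.2, abs_deriv_bump_le ht hs]
    _ = 19 / t := by field_simp; norm_num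

theorem integral_flow_controlCoeff (hm : m ≠ 0) (β : ℝ) (ht : t ≠ 0) :
    ∫ r in (0 : ℝ)..t, flow (blockOp m β) (t - r) (controlCoeff m β t r • Complex.I) =
      -flow (blockOp m β) t Complex.I :=
  integral_flow_smul_eq_neg_flow (flow_blockOp_I hm β) (contDiff_bump t).continuous
    ((contDiff_position hm β).mul (contDiff_bump t)) (by simp) (by simp [bump]) (integral_bump ht)

end ScalarControl

section SpectralFormula

theorem eq_exp_mul_of_hasDerivAt {q : ℝ → ℂ} {l : ℂ} (hq : ∀ s, HasDerivAt q (l * q s) s)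
    (s : ℝ) : q s = Complex.exp (l * s) * q 0 := by
  have hexp (r : ℝ) : HasDerivAt (fun r : ℝ => Complex.exp (-(l * r)))
      (Complex.exp (-(l * r)) * -l) r :=
    HasDerivAt.cexp ((((Complex.ofRealCLM.hasDerivAt (x := r)).const_mul l).neg).congr_deriv
      (by simp))
  have hderiv (r : ℝ) : HasDerivAt (fun r : ℝ => Complex.exp (-(l * r)) * q r) 0 r :=
    ((hexp r).mul (hq r)).congr_deriv (by ring)
  have hconst : Complex.exp (-(l * s)) * q s = q 0 := by
    simpa using is_const_of_deriv_eq_zero (fun r => (hderiv r).differentiableAt)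
      (fun r => (hderiv r).deriv) s 0
  rw [← hconst, ← mul_assoc, ← Complex.exp_add]
  simp

theorem velocity_sub_mul_position {m β : ℝ} (hm : m ≠ 0) {l l' : ℂ} (hsum : l + l' = -β)
    (hprod : l * l' = (m : ℂ) ^ 2) (s : ℝ) :
    (velocity m β s : ℂ) - l' * position m β s = Complex.exp (l * s) := by
  have hode (r : ℝ) : HasDerivAt (fun r => (velocity m β r : ℂ) - l' * position m β r)
      (l * ((velocity m β r : ℂ) - l' * position m β r)) r := by
    refine ((hasDerivAt_velocity m β r).ofReal_comp.sub
      ((hasDerivAt_position hm β r).ofReal_comp.const_mul l')).congr_deriv ?_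
    push_cast
    linear_combination (position m β r : ℂ) * hprod - (velocity m β r : ℂ) * hsum
  simpa using eq_exp_mul_of_hasDerivAt hode s

variable {α ρ μ : ℝ}

theorem rootP_add_rootM (α ρ μ : ℝ) : rootP α ρ μ + rootM α ρ μ = -((ρ * μ ^ α : ℝ) : ℂ) := by
  rw [rootP, rootM]
  ring

theorem rootP_mul_rootM (hμ : 0 ≤ μ) (α ρ : ℝ) : rootP α ρ μ * rootM α ρ μ = (√μ : ℂ) ^ 2 := by
  have hsqrt : (√μ : ℂ) ^ 2 = μ := by rw [← Complex.ofReal_pow, Real.sq_sqrt hμ]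
  have hpow : μ ^ (2 * α) = (μ ^ α) ^ 2 := by
    rw [mul_comm, Real.rpow_mul hμ, Real.rpow_two]
  have hdisc : (((ρ ^ 2 * μ ^ (2 * α) - 4 * μ : ℝ) : ℂ) ^ (1 / 2 : ℂ)) ^ 2 =
      ((ρ * μ ^ α : ℝ) : ℂ) ^ 2 - 4 * μ := by
    rw [← Complex.cpow_nat_mul, hpow]
    push_cast
    norm_num
    ring
  rw [rootP, rootM, hsqrt]
  linear_combination (-1 / 4 : ℂ) * hdisc

theorem rootM_sub_rootP_ne_zero (hdisc : ρ ^ 2 * μ ^ (2 * α) - 4 * μ ≠ 0) :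
    rootM α ρ μ - rootP α ρ μ ≠ 0 := by
  have hdiff : rootM α ρ μ - rootP α ρ μ =
      -((ρ ^ 2 * μ ^ (2 * α) - 4 * μ : ℝ) : ℂ) ^ (1 / 2 : ℂ) := by
    rw [rootP, rootM]
    ring
  rw [hdiff, neg_ne_zero, Complex.cpow_ne_zero_iff_of_exponent_ne_zero (by norm_num)]
  exact Complex.ofReal_ne_zero.2 hdisc

theorem exp_rootP_mul (hμ : 0 < μ) (α ρ s : ℝ) :
    Complex.exp (rootP α ρ μ * s) =
      velocity √μ (ρ * μ ^ α) s - rootM α ρ μ * position √μ (ρ * μ ^ α) s :=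
  (velocity_sub_mul_position (Real.sqrt_pos.2 hμ).ne' (rootP_add_rootM α ρ μ)
    (rootP_mul_rootM hμ.le α ρ) s).symm

theorem exp_rootM_mul (hμ : 0 < μ) (α ρ s : ℝ) :
    Complex.exp (rootM α ρ μ * s) =
      velocity √μ (ρ * μ ^ α) s - rootP α ρ μ * position √μ (ρ * μ ^ α) s :=
  (velocity_sub_mul_position (Real.sqrt_pos.2 hμ).ne'
    ((add_comm _ _).trans (rootP_add_rootM α ρ μ))
    ((mul_comm _ _).trans (rootP_mul_rootM hμ.le α ρ)) s).symm

theorem coeffZero_eq (hμ : 0 < μ) (hdisc : ρ ^ 2 * μ ^ (2 * α) - 4 * μ ≠ 0) (t s : ℝ) :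
    coeffZero α ρ μ t s = ((-((velocity √μ (ρ * μ ^ α) s +
      ρ * μ ^ α * position √μ (ρ * μ ^ α) s) * bump t s) : ℝ) : ℂ) := by
  rw [coeffZero, exp_rootP_mul hμ, exp_rootM_mul hμ]
  simp only [Complex.ofReal_neg, Complex.ofReal_mul (_ + _), Complex.ofReal_add,
    Complex.ofReal_mul (ρ * μ ^ α), neg_mul, neg_inj]
  congr 1
  rw [div_eq_iff (rootM_sub_rootP_ne_zero hdisc)]
  linear_combination ((rootP α ρ μ - rootM α ρ μ) * position √μ (ρ * μ ^ α) s) *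
    rootP_add_rootM α ρ μ

theorem coeffOne_eq (hμ : 0 < μ) (hdisc : ρ ^ 2 * μ ^ (2 * α) - 4 * μ ≠ 0) (t s : ℝ) :
    coeffOne α ρ μ t s = ((-(position √μ (ρ * μ ^ α) s * bump t s) : ℝ) : ℂ) := by
  rw [coeffOne, exp_rootP_mul hμ, exp_rootM_mul hμ]
  simp only [Complex.ofReal_neg, Complex.ofReal_mul, neg_mul, neg_inj]
  congr 1
  rw [div_eq_iff (rootM_sub_rootP_ne_zero hdisc)]
  ring

theorem coeffZero_add_deriv_coeffOne (hμ : 0 < μ) (hdisc : ρ ^ 2 * μ ^ (2 * α) - 4 * μ ≠ 0)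
    (t s : ℝ) : coeffZero α ρ μ t s + deriv (coeffOne α ρ μ t) s =
      (controlCoeff √μ (ρ * μ ^ α) t s : ℂ) := by
  have hcontDiff :=
    (contDiff_position (Real.sqrt_pos.2 hμ).ne' (ρ * μ ^ α)).mul (contDiff_bump t)
  have hderiv : HasDerivAt (coeffOne α ρ μ t)
      ((-deriv (fun r => position √μ (ρ * μ ^ α) r * bump t r) s : ℝ) : ℂ) s := by
    rw [funext (coeffOne_eq hμ hdisc t)]
    exact ((hcontDiff.differentiable one_ne_zero s).hasDerivAt.neg).ofReal_comp
  rw [coeffZero_eq hμ hdisc, hderiv.deriv, ← Complex.ofReal_add, controlCoeff, sub_eq_add_neg]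

end SpectralFormula

/-! ### Spectral theory -/

theorem IsTraceClass.isCompactOperator {E : Type*} [NormedAddCommGroup E] [InnerProductSpace ℝ E]
    [CompleteSpace E] {R : E →L[ℝ] E} (h : IsTraceClass R) : IsCompactOperator R := by
  obtain ⟨x, y, hxy, hR⟩ := h
  let term (n : ℕ) : E →L[ℝ] E := InnerProductSpace.rankOne ℝ (y n) (x n)
  have hsummable : Summable term :=
    .of_norm (hxy.congr fun n => by simp [term, InnerProductSpace.norm_rankOne, mul_comm])
  have hsum : HasSum term R := by
    convert hsummable.hasSum
    ext z
    exact (hR z).unique (hsummable.hasSum.mapL (ContinuousLinearMap.apply ℝ E z))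
  have hterm (n : ℕ) : term n ∈ compactOperator (RingHom.id ℝ) E E :=
    ((isCompactOperator_id (E := ℝ)).comp_clm (innerSL ℝ (x n))).clm_comp
      (ContinuousLinearMap.toSpanSingleton ℝ (y n))
  exact isCompactOperator_of_tendsto hsum
    (Eventually.of_forall fun s => Submodule.sum_mem _ fun n _ => hterm n)

section Compact

universe u v

variable {𝕜 : Type u} [RCLike 𝕜] {E : Type v} [NormedAddCommGroup E] [InnerProductSpace 𝕜 E]
  [CompleteSpace E]

theorem exists_hilbertBasis_sigma {κ : Type*} {V : κ → Submodule 𝕜 E} [∀ k, CompleteSpace (V k)]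
    (hV : OrthogonalFamily 𝕜 (fun k => V k) fun k => (V k).subtypeₗᵢ) (hbot : (⨆ k, V k)ᗮ = ⊥)
    {w : κ → Type*} (b : ∀ k, HilbertBasis (w k) 𝕜 (V k)) :
    ∃ B : HilbertBasis (Σ k, w k) 𝕜 E, ∀ p, B p = b p.1 p.2 := by
  have hortho : Orthonormal 𝕜 fun p : Σ k, w k => (b p.1 p.2 : E) :=
    hV.orthonormal_sigma_orthonormal fun k => (b k).orthonormal
  have hspan : (Submodule.span 𝕜 (range fun p : Σ k, w k => (b p.1 p.2 : E)))ᗮ = ⊥ := by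
    rw [eq_bot_iff, ← hbot, ← Submodule.iInf_orthogonal]
    refine fun x hx => (Submodule.mem_iInf _).2 fun k => ?_
    rw [← Submodule.orthogonalProjectionOnto_eq_zero_iff]
    have horth (i : w k) : inner 𝕜 (b k i : E) x = 0 :=
      (Submodule.mem_orthogonal _ x).1 hx _ (Submodule.subset_span ⟨⟨k, i⟩, rfl⟩)
    exact ((b k).hasSum_orthogonalProjectionOnto x).unique (by simp [horth, hasSum_zero])
  exact ⟨.mkOfOrthogonalEqBot hortho hspan, by simp⟩

theorem exists_hilbertBasis_eigenvectors {T : E →L[𝕜] E} (hT : IsCompactOperator T)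
    (hsymm : T.IsSymmetric) : ∃ (ι : Type (max u v)) (b : HilbertBasis ι 𝕜 E) (ν : ι → 𝕜),
      ∀ i, T (b i) = ν i • b i := by
  have hcomplete (ν : 𝕜) : CompleteSpace (Module.End.eigenspace (T : E →ₗ[𝕜] E) ν) := by
    rw [Module.End.eigenspace_def]
    exact (T - algebraMap 𝕜 (E →L[𝕜] E) ν).isClosed_ker.completeSpace_coe
  choose w b _ using fun ν : 𝕜 => exists_hilbertBasis 𝕜 (Module.End.eigenspace (T : E →ₗ[𝕜] E) ν)
  obtain ⟨B, hB⟩ := exists_hilbertBasis_sigma hsymm.orthogonalFamily_eigenspaces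
    (ContinuousLinearMap.orthogonalComplement_iSup_eigenspaces_eq_bot hT hsymm) b
  refine ⟨_, B, Sigma.fst, fun p => ?_⟩
  rw [hB]
  exact Module.End.mem_eigenspace_iff.1 (b p.1 p.2).2

end Compact

section Diagonal

variable {ι E : Type*} [NormedAddCommGroup E] [InnerProductSpace ℝ E] (b : HilbertBasis ι ℝ E)

theorem eq_of_repr_apply_eq {x y : E} (h : ∀ i, b.repr x i = b.repr y i) : x = y :=
  b.repr.injective (lp.ext (funext h))

/-- The graph of the self-adjoint operator with eigenvectors `b i` and eigenvalues `ν i`, with its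
maximal domain. -/
def diagGraph (ν : ι → ℝ) : Set (E × E) := {p | ∀ i, b.repr p.2 i = ν i * b.repr p.1 i}

theorem isClosed_diagGraph (ν : ι → ℝ) : IsClosed (diagGraph b ν) := by
  simp only [diagGraph, ofPred_forall, HilbertBasis.repr_apply_apply]
  exact isClosed_iInter fun i => isClosed_eq (by fun_prop) (by fun_prop)

theorem mk_smul_mem_diagGraph (ν : ι → ℝ) (i : ι) : (b i, ν i • b i) ∈ diagGraph b ν := by
  classical
  intro j
  rcases eq_or_ne j i with rfl | hij
  · simp
  · simp [b.repr_self, hij]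

theorem closure_eq_diagGraph {ν : ι → ℝ} {S : Submodule ℝ (E × E)}
    (hS : (S : Set (E × E)) ⊆ diagGraph b ν) (hb : ∀ i, (b i, ν i • b i) ∈ S) :
    closure (S : Set (E × E)) = diagGraph b ν := by
  refine subset_antisymm (closure_minimal hS (isClosed_diagGraph b ν)) fun p hp => ?_
  refine mem_closure_of_tendsto ((b.hasSum_repr p.1).prodMk (b.hasSum_repr p.2))
    (Eventually.of_forall fun s => S.sum_mem fun i _ => ?_)
  rw [hp i, mul_comm, mul_smul, ← Prod.smul_mk]
  exact S.smul_mem _ (hb i)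

variable {b} {ν : ι → ℝ}

theorem inner_eq_mul_inner_of_mem_diagGraph {g : ℝ → ℝ} {x y e : E} {μ : ℝ}
    (hxy : (x, y) ∈ diagGraph b fun i => g (ν i)) (he : (e, μ • e) ∈ diagGraph b ν) :
    inner ℝ y e = g μ * inner ℝ x e := by
  have hterm (i : ι) : inner ℝ y (b i) * inner ℝ (b i) e =
      g μ * (inner ℝ x (b i) * inner ℝ (b i) e) := by
    have hx := hxy i
    have hei : μ * inner ℝ (b i) e = ν i * inner ℝ (b i) e := by
      simpa [HilbertBasis.repr_apply_apply, inner_smul_right] using he i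
    simp only [HilbertBasis.repr_apply_apply] at hx
    rw [real_inner_comm, hx, real_inner_comm x]
    rcases mul_eq_mul_right_iff.1 hei with hμ | h0
    · rw [hμ, mul_assoc]
    · simp [h0]
  refine (b.hasSum_inner_mul_inner y e).unique ?_
  simpa only [hterm] using (b.hasSum_inner_mul_inner x e).mul_left (g μ)

theorem spectralPower_diagGraph (b : HilbertBasis ι ℝ E) (ν : ι → ℝ) (s : ℝ) :
    spectralPower (diagGraph b ν) s = diagGraph b fun i => ν i ^ s := by
  ext p
  refine ⟨fun hp i => ?_, fun hp e μ he =>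
    inner_eq_mul_inner_of_mem_diagGraph (g := fun μ => μ ^ s) hp he⟩
  simpa only [HilbertBasis.repr_apply_apply, real_inner_comm] using
    hp (b i) (ν i) (mk_smul_mem_diagGraph b ν i)

/-- The operator with eigenvectors `b i` and eigenvalues `c i`, where `c` is bounded. -/
def diagMul (b : HilbertBasis ι ℝ E) (c : ι → ℝ) (x : E) : E := ∑' i, (c i * b.repr x i) • b i

variable {c : ι → ℝ} {M : ℝ}

theorem norm_mul_repr_apply_le (hM : 0 ≤ M) (hc : ∀ i, |c i| ≤ M) (x : E) (i : ι) :
    ‖c i * b.repr x i‖ ≤ ‖(M • b.repr x) i‖ := by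
  rw [lp.coeFn_smul, Pi.smul_apply, smul_eq_mul, norm_mul, norm_mul, Real.norm_of_nonneg hM]
  exact mul_le_mul_of_nonneg_right (hc i) (norm_nonneg _)

theorem repr_diagMul (hM : 0 ≤ M) (hc : ∀ i, |c i| ≤ M) (x : E) (i : ι) :
    b.repr (diagMul b c x) i = c i * b.repr x i := by
  let f : lp (fun _ : ι => ℝ) 2 :=
    ⟨fun i => c i * b.repr x i, (lp.memℓp (M • b.repr x)).mono' (norm_mul_repr_apply_le hM hc x)⟩
  have hf : diagMul b c x = b.repr.symm f := (b.hasSum_repr_symm f).tsum_eq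
  rw [hf, LinearIsometryEquiv.apply_symm_apply]

theorem norm_diagMul_le (hM : 0 ≤ M) (hc : ∀ i, |c i| ≤ M) (x : E) :
    ‖diagMul b c x‖ ≤ M * ‖x‖ := by
  rw [← b.repr.norm_map, ← b.repr.norm_map x, ← Real.norm_of_nonneg hM, ← norm_smul]
  refine lp.norm_mono (by norm_num) fun i => ?_
  rw [repr_diagMul hM hc]
  exact norm_mul_repr_apply_le hM hc x i

theorem continuous_diagMul {X : Type*} [TopologicalSpace X] {c : X → ι → ℝ} (hM : 0 ≤ M)
    (hc : ∀ s i, |c s i| ≤ M) (hcont : ∀ i, Continuous fun s => c s i) (x : E) :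
    Continuous fun s => diagMul b (c s) x := by
  suffices Continuous fun s => b.repr (diagMul b (c s) x) by
    simpa [Function.comp_def] using b.repr.symm.continuous.comp this
  refine continuous_iff_continuousAt.2 fun s =>
    tendsto_lp_of_dominated (by norm_num) (lp.memℓp (M • b.repr x)).norm
      (Eventually.of_forall fun r i => ?_) fun i => ?_
  · rw [repr_diagMul hM (hc r)]
    exact norm_mul_repr_apply_le hM (hc r) x i
  · simp only [repr_diagMul hM (hc _)]
    exact ((hcont i).mul continuous_const).tendsto s

end Diagonal

/-! ### The space `V'` in coordinates -/

section EigenBasis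

universe u

variable {U : Type u} [NormedAddCommGroup U] [InnerProductSpace ℝ U] [CompleteSpace U]

theorem inner_incl (Λ : PosOp U) (x y : U) :
    inner ℝ (incl Λ x) (incl Λ y) = inner ℝ (Λ.inv x) y :=
  UniformSpace.Completion.inner_coe (𝕜 := ℝ) (PreVDual.of Λ x) (PreVDual.of Λ y)

theorem continuous_incl (Λ : PosOp U) : Continuous (incl Λ) := by
  refine AddMonoidHomClass.continuous_of_bound (incl Λ) (√‖Λ.inv‖) fun x => ?_
  rw [← Real.sqrt_sq (norm_nonneg x), ← Real.sqrt_mul (norm_nonneg _)]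
  refine Real.le_sqrt_of_sq_le ?_
  calc ‖incl Λ x‖ ^ 2 = inner ℝ (Λ.inv x) x := by rw [← real_inner_self_eq_norm_sq, inner_incl]
    _ ≤ ‖Λ.inv x‖ * ‖x‖ := real_inner_le_norm _ _
    _ ≤ ‖Λ.inv‖ * ‖x‖ * ‖x‖ := by gcongr; exact Λ.inv.le_opNorm x
    _ = ‖Λ.inv‖ * ‖x‖ ^ 2 := by ring

theorem denseRange_incl (Λ : PosOp U) : DenseRange (incl Λ) :=
  UniformSpace.Completion.denseRange_coe (α := PreVDual Λ)

/-- A Hilbert basis of `U` consisting of eigenvectors of `Λ`. The eigenvalue equation is stated for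
`Λ⁻¹`, which is defined on all of `U`. -/
structure EigenBasis (Λ : PosOp U) (ι : Type*) where
  basis : HilbertBasis ι ℝ U
  eig : ι → ℝ
  eig_pos : ∀ i, 0 < eig i
  inv_basis : ∀ i, Λ.inv (basis i) = (eig i)⁻¹ • basis i

theorem exists_eigenBasis (Λ : PosOp U) (hΛ : IsCompactOperator Λ.inv) :
    ∃ ι : Type u, Nonempty (EigenBasis Λ ι) := by
  obtain ⟨ι, b, ν, hν⟩ := exists_hilbertBasis_eigenvectors hΛ fun x y => Λ.inv_symm x y
  have hν_pos (i : ι) : 0 < ν i := by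
    have hinner : inner ℝ (Λ.inv (b i)) (b i) = ν i := by
      rw [hν, real_inner_smul_left, real_inner_self_eq_norm_sq, b.orthonormal.1 i]
      simp
    rw [← hinner]
    exact (Λ.inv_nonneg (b i)).lt_of_ne'
      fun h => b.orthonormal.ne_zero i (Λ.inv_definite (b i) h)
  exact ⟨ι, ⟨⟨b, fun i => (ν i)⁻¹, fun i => inv_pos.2 (hν_pos i), fun i => by simp [hν]⟩⟩⟩

namespace EigenBasis

variable {Λ : PosOp U} {ι : Type*} (B : EigenBasis Λ ι)

theorem sqrt_eig_ne_zero (i : ι) : √(B.eig i) ≠ 0 := (Real.sqrt_pos.2 (B.eig_pos i)).ne'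

theorem mem_domain (i : ι) : B.basis i ∈ Λ.op.domain := by
  have h := Λ.op.domain.smul_mem (B.eig i) (Λ.inv_mem (B.basis i))
  rwa [B.inv_basis, smul_inv_smul₀ (B.eig_pos i).ne'] at h

theorem op_basis (i : ι) : Λ.op ⟨B.basis i, B.mem_domain i⟩ = B.eig i • B.basis i := by
  have hinv : (⟨B.basis i, B.mem_domain i⟩ : Λ.op.domain) =
      B.eig i • ⟨Λ.inv (B.basis i), Λ.inv_mem _⟩ :=
    Subtype.ext (by simp [B.inv_basis, smul_inv_smul₀ (B.eig_pos i).ne'])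
  rw [hinv, LinearPMap.map_smul, Λ.op_inv]

theorem repr_op (x : Λ.op.domain) (i : ι) :
    B.basis.repr (Λ.op x) i = B.eig i * B.basis.repr (x : U) i := by
  have h := Λ.inv_symm (B.basis i) (Λ.op x)
  rw [Λ.inv_op, B.inv_basis, real_inner_smul_left] at h
  rw [HilbertBasis.repr_apply_apply, HilbertBasis.repr_apply_apply, ← h,
    mul_inv_cancel_left₀ (B.eig_pos i).ne']

/-- The eigenvectors of `Λ`, normalised in `V'`. -/
def dualVec (i : ι) : VDual Λ := √(B.eig i) • incl Λ (B.basis i)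

theorem inner_dualVec_incl (i : ι) (x : U) :
    inner ℝ (B.dualVec i) (incl Λ x) = (√(B.eig i))⁻¹ * inner ℝ (B.basis i) x := by
  have hsqrt : √(B.eig i) * (B.eig i)⁻¹ = (√(B.eig i))⁻¹ := by
    rw [← div_eq_mul_inv, Real.sqrt_div_self]
  rw [dualVec, real_inner_smul_left, inner_incl, B.inv_basis, real_inner_smul_left, ← mul_assoc,
    hsqrt]

theorem orthonormal_dualVec : Orthonormal ℝ B.dualVec := by
  classical
  rw [orthonormal_iff_ite]
  intro i j
  have h := orthonormal_iff_ite.1 B.basis.orthonormal i j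
  rw [dualVec.eq_def B j, real_inner_smul_right, B.inner_dualVec_incl, h]
  split_ifs with hij
  · rw [hij, mul_one, mul_inv_cancel₀ (B.sqrt_eig_ne_zero j)]
  · simp

theorem span_dualVec_orthogonal : (Submodule.span ℝ (range B.dualVec))ᗮ = ⊥ := by
  refine eq_bot_iff.2 fun z hz => ?_
  have hbasis (i : ι) : inner ℝ z (incl Λ (B.basis i)) = 0 := by
    have h := (Submodule.mem_orthogonal' _ z).1 hz _ (Submodule.subset_span (mem_range_self i))
    rw [dualVec, real_inner_smul_right] at h
    exact (mul_eq_zero.1 h).resolve_left (B.sqrt_eig_ne_zero i)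
  have hincl (x : U) : inner ℝ z (incl Λ x) = 0 := by
    have hx := ((B.basis.hasSum_repr x).map (incl Λ) (continuous_incl Λ)).mapL (innerSL ℝ z)
    exact hx.unique (by simp [hbasis, hasSum_zero])
  exact (denseRange_incl Λ).eq_zero_of_inner_left ℝ (by simpa using hincl)

/-- The Hilbert basis of `V'` consisting of eigenvectors of `Λ`. -/
def dualBasis : HilbertBasis ι ℝ (VDual Λ) :=
  HilbertBasis.mkOfOrthogonalEqBot B.orthonormal_dualVec B.span_dualVec_orthogonal

theorem dualBasis_apply (i : ι) : B.dualBasis i = B.dualVec i := by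
  rw [dualBasis, HilbertBasis.coe_mkOfOrthogonalEqBot]

theorem dualBasis_repr_incl (x : U) (i : ι) :
    B.dualBasis.repr (incl Λ x) i = (√(B.eig i))⁻¹ * B.basis.repr x i := by
  rw [HilbertBasis.repr_apply_apply, HilbertBasis.repr_apply_apply, dualBasis_apply,
    ← B.inner_dualVec_incl]

theorem extGraph_eq : extGraph Λ = diagGraph B.dualBasis B.eig := by
  let S : Submodule ℝ (VDual Λ × VDual Λ) := Λ.op.graph.map ((incl Λ).prodMap (incl Λ))
  have hS : {p | ∃ x : Λ.op.domain, p = (incl Λ (x : U), incl Λ (Λ.op x))} = (S : Set _) := by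
    ext p
    constructor
    · rintro ⟨x, rfl⟩
      exact ⟨_, Λ.op.mem_graph x, rfl⟩
    · rintro ⟨q, hq, rfl⟩
      obtain ⟨x, hx, hopx⟩ := Λ.op.mem_graph_iff.1 hq
      exact ⟨x, by simp [hx, hopx]⟩
  rw [extGraph, hS]
  refine closure_eq_diagGraph B.dualBasis ?_ fun i => ?_
  · rw [← hS]
    rintro _ ⟨x, rfl⟩ i
    simp only [dualBasis_repr_incl, repr_op]
    ring
  · have hmem := S.smul_mem √(B.eig i)
      (Submodule.mem_map_of_mem (Λ.op.mem_graph ⟨B.basis i, B.mem_domain i⟩))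
    simpa [dualBasis_apply, dualVec, B.op_basis, smul_comm (B.eig i)] using hmem

theorem powGraph_eq (s : ℝ) : powGraph Λ s = diagGraph B.dualBasis fun i => B.eig i ^ s := by
  rw [powGraph, B.extGraph_eq, spectralPower_diagGraph]

end EigenBasis

end EigenBasis

/-! ### The damped wave operators in coordinates -/

section Coordinates

variable {ι : Type*} {E : Type*} [NormedAddCommGroup E] [InnerProductSpace ℝ E]
  {F : Type*} [NormedAddCommGroup F] [InnerProductSpace ℝ F]

theorem inner_self_complex_mk (x y : ℝ) :
    inner ℝ (⟨x, y⟩ : ℂ) ⟨x, y⟩ = inner ℝ x x + inner ℝ y y := by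
  rw [real_inner_self_eq_norm_sq, Complex.sq_norm, Complex.normSq_mk]
  rfl

theorem memℓp_complex_mk (x y : lp (fun _ : ι => ℝ) 2) :
    Memℓp (fun i => (⟨x i, y i⟩ : ℂ)) 2 :=
  ((lp.memℓp x).norm.add (lp.memℓp y).norm).mono fun _ => Complex.norm_le_abs_re_add_abs_im _

/-- The identification of a product of two Hilbert spaces with `ℓ²(ι, ℂ)` given by a pair of
Hilbert bases with the same index set; `ℂ` stands for the Euclidean plane. -/
def pairIso (b : HilbertBasis ι ℝ E) (c : HilbertBasis ι ℝ F) :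
    WithLp 2 (E × F) ≃ₗᵢ[ℝ] lp (fun _ : ι => ℂ) 2 :=
  LinearIsometryEquiv.ofSurjective
    { toFun := fun p => ⟨fun i => ⟨b.repr p.fst i, c.repr p.snd i⟩, memℓp_complex_mk _ _⟩
      map_add' := fun p q => by
        ext i
        apply Complex.ext <;> simp <;> rfl
      map_smul' := fun r p => by
        ext i
        apply Complex.ext <;> simp
      norm_map' := fun p => by
        refine (sq_eq_sq₀ (norm_nonneg _) (norm_nonneg _)).1 ?_
        rw [WithLp.prod_norm_sq_eq_of_L2, ← b.repr.norm_map p.fst, ← c.repr.norm_map p.snd]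
        simp only [← real_inner_self_eq_norm_sq, lp.inner_eq_tsum]
        rw [← (lp.summable_inner (𝕜 := ℝ) _ _).tsum_add (lp.summable_inner (𝕜 := ℝ) _ _)]
        exact tsum_congr fun i => inner_self_complex_mk _ _ }
    fun z => by
      have hre : Memℓp (fun i => (z i).re) 2 :=
        (lp.memℓp z).mono' fun i => Complex.abs_re_le_norm _
      have him : Memℓp (fun i => (z i).im) 2 :=
        (lp.memℓp z).mono' fun i => Complex.abs_im_le_norm _
      refine ⟨WithLp.toLp 2 (b.repr.symm ⟨_, hre⟩, c.repr.symm ⟨_, him⟩), ?_⟩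
      ext i
      apply Complex.ext <;> simp

theorem pairIso_apply (b : HilbertBasis ι ℝ E) (c : HilbertBasis ι ℝ F) (p : WithLp 2 (E × F))
    (i : ι) : pairIso b c p i = ⟨b.repr p.fst i, c.repr p.snd i⟩ := rfl

/-- The damped wave operator in coordinates, with eigenvalues `μ i`: on its domain both
`√μ i * (z i).re` and `μ i ^ α * (z i).im` are square summable, and not only the combination of
them that enters its values. -/
def coordGraph (μ : ι → ℝ) (α ρ : ℝ) : Set (lp (fun _ : ι => ℂ) 2 × lp (fun _ : ι => ℂ) 2) :=
  {p | ∃ b c : lp (fun _ : ι => ℝ) 2, ∀ i, b i = √(μ i) * (p.1 i).re ∧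
    c i = μ i ^ α * (p.1 i).im ∧ p.2 i = ⟨√(μ i) * (p.1 i).im, -b i - ρ * c i⟩}

theorem closure_coordGraph (μ : ι → ℝ) (α ρ : ℝ) :
    closure (coordGraph μ α ρ) = blockGraph fun i => blockOp √(μ i) (ρ * μ i ^ α) := by
  refine closure_eq_blockGraph _ ?_ fun p hp hfin => ?_
  · rintro p ⟨b, c, h⟩ i
    obtain ⟨hb, hc, hp⟩ := h i
    rw [hp, hb, hc]
    apply Complex.ext
    · simp
    · simp only [blockOp_im]
      ring
  · have hmem (f : ι → ℂ → ℝ) (hf : ∀ i, f i 0 = 0) : Memℓp (fun i => f i (p.1 i)) 2 :=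
      memℓp_of_finite_support (hfin.subset fun i hi h0 => hi (by rw [h0, hf])) 2
    refine ⟨⟨_, hmem (fun i z => √(μ i) * z.re) (by simp)⟩,
      ⟨_, hmem (fun i z => μ i ^ α * z.im) (by simp)⟩, fun i => ⟨rfl, rfl, ?_⟩⟩
    rw [hp i]
    apply Complex.ext
    · simp
    · simp only [blockOp_im]
      ring

theorem map_pairIso_mem_coordGraph_iff (b : HilbertBasis ι ℝ E) (c : HilbertBasis ι ℝ F)
    (μ : ι → ℝ) (α ρ : ℝ) (p : WithLp 2 (E × F) × WithLp 2 (E × F)) :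
    Prod.map (pairIso b c) (pairIso b c) p ∈ coordGraph μ α ρ ↔
      (∀ i, b.repr p.2.fst i = √(μ i) * c.repr p.1.snd i) ∧
        ∃ x y : F, (∀ i, c.repr x i = √(μ i) * b.repr p.1.fst i) ∧
          (∀ i, c.repr y i = μ i ^ α * c.repr p.1.snd i) ∧ p.2.snd = -x - ρ • y := by
  simp only [coordGraph, mem_ofPred_eq, Prod.map_fst, Prod.map_snd, pairIso_apply,
    Complex.mk.injEq]
  constructor
  · rintro ⟨x, y, h⟩
    refine ⟨fun i => (h i).2.2.1, c.repr.symm x, c.repr.symm y, fun i => ?_, fun i => ?_,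
      eq_of_repr_apply_eq c fun i => ?_⟩
    · simpa using (h i).1
    · simpa using (h i).2.1
    · rw [(h i).2.2.2, map_sub, map_neg, map_smul, LinearIsometryEquiv.apply_symm_apply,
        LinearIsometryEquiv.apply_symm_apply]
      rfl
  · rintro ⟨hfst, x, y, hx, hy, hsnd⟩
    refine ⟨c.repr x, c.repr y, fun i => ⟨hx i, hy i, hfst i, ?_⟩⟩
    rw [hsnd, map_sub, map_neg, map_smul]
    rfl

end Coordinates

namespace EigenBasis

variable {U : Type*} [NormedAddCommGroup U] [InnerProductSpace ℝ U] [CompleteSpace U]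
  {Λ : PosOp U} {ι : Type*} (B : EigenBasis Λ ι)

theorem waveGraphT_eq (α ρ : ℝ) : waveGraphT Λ α ρ =
    Prod.map (pairIso B.dualBasis B.dualBasis) (pairIso B.dualBasis B.dualBasis) ⁻¹'
      coordGraph B.eig α ρ := by
  ext p
  rw [mem_preimage, map_pairIso_mem_coordGraph_iff]
  simp only [waveGraphT, B.powGraph_eq, ← Real.sqrt_eq_rpow, diagGraph, mem_ofPred_eq]

theorem waveGraph_eq (α ρ : ℝ) : waveGraph Λ α ρ =
    Prod.map (pairIso B.basis B.dualBasis) (pairIso B.basis B.dualBasis) ⁻¹'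
      coordGraph B.eig α ρ := by
  ext p
  rw [mem_preimage, map_pairIso_mem_coordGraph_iff]
  have hvelocity : incl Λ p.2.fst = p.1.snd ↔
      ∀ i, B.basis.repr p.2.fst i = √(B.eig i) * B.dualBasis.repr p.1.snd i := by
    refine ⟨fun h i => ?_, fun h => eq_of_repr_apply_eq B.dualBasis fun i => ?_⟩
    · rw [← h, dualBasis_repr_incl, mul_inv_cancel_left₀ (B.sqrt_eig_ne_zero i)]
    · rw [dualBasis_repr_incl, h, inv_mul_cancel_left₀ (B.sqrt_eig_ne_zero i)]
  have hsqrt (i : ι) : B.eig i * (√(B.eig i))⁻¹ = √(B.eig i) := by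
    rw [← div_eq_mul_inv, Real.div_sqrt]
  simp only [waveGraph, hvelocity, B.extGraph_eq, B.powGraph_eq, diagGraph, mem_ofPred_eq,
    dualBasis_repr_incl, ← mul_assoc, hsqrt]

theorem pairIso_dualBasis_Gt (a : VDual Λ) (i : ι) :
    pairIso B.dualBasis B.dualBasis (Gt Λ a) i = B.dualBasis.repr a i • Complex.I := by
  apply Complex.ext <;> simp [pairIso_apply, Gt]

theorem pairIso_basis_G (a : VDual Λ) :
    pairIso B.basis B.dualBasis (G Λ a) = pairIso B.dualBasis B.dualBasis (Gt Λ a) := by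
  ext i
  apply Complex.ext <;> simp [pairIso_apply, Gt, G]

include B in
theorem steers_waveGraph_iff {α ρ T t : ℝ} {a : VDual Λ} {u : ℝ → VDual Λ} :
    Steers (waveGraph Λ α ρ) (G Λ) T t (G Λ a) u ↔
      Steers (waveGraphT Λ α ρ) (Gt Λ) T t (Gt Λ a) u := by
  have hG : (pairIso B.basis B.dualBasis).toContinuousLinearEquiv.toContinuousLinearMap ∘L G Λ =
      (pairIso B.dualBasis B.dualBasis).toContinuousLinearEquiv.toContinuousLinearMap ∘L Gt Λ :=
    ContinuousLinearMap.ext B.pairIso_basis_G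
  rw [B.waveGraph_eq, B.waveGraphT_eq]
  refine (steers_preimage_iff (pairIso B.basis B.dualBasis).toContinuousLinearEquiv).trans
    (Iff.trans ?_
      (steers_preimage_iff (pairIso B.dualBasis B.dualBasis).toContinuousLinearEquiv).symm)
  rw [hG]
  exact iff_of_eq (congrArg (Steers _ _ T t · u) (B.pairIso_basis_G a))

include B in
theorem controlEnergy_waveGraphT_eq (α ρ T t : ℝ) (a : VDual Λ) :
    controlEnergy (waveGraphT Λ α ρ) (Gt Λ) T t (Gt Λ a) =
      controlEnergy (waveGraph Λ α ρ) (G Λ) T t (G Λ a) := by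
  simp only [controlEnergy, B.steers_waveGraph_iff]

/-! ### The control -/

/-- The control that steers `G a` to `0` at time `t`: along each eigenvector of `Λ`, `a` is
multiplied by the coefficient that steers the corresponding mode. The time is clamped to `[0, t]`,
where these coefficients are bounded uniformly in the eigenvalue. -/
def control (α ρ t : ℝ) (a : VDual Λ) (s : ℝ) : VDual Λ :=
  diagMul B.dualBasis
    (fun i => controlCoeff √(B.eig i) (ρ * B.eig i ^ α) t (max 0 (min s t))) a

variable (α : ℝ) {ρ t : ℝ}

theorem mul_rpow_eig_nonneg (hρ : 0 ≤ ρ) (i : ι) : 0 ≤ ρ * B.eig i ^ α :=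
  mul_nonneg hρ (Real.rpow_nonneg (B.eig_pos i).le _)

theorem abs_controlCoeff_eig_le (hρ : 0 ≤ ρ) (ht : 0 < t) (s : ℝ) (i : ι) :
    |controlCoeff √(B.eig i) (ρ * B.eig i ^ α) t (max 0 (min s t))| ≤ 19 / t :=
  abs_controlCoeff_le (B.sqrt_eig_ne_zero i) (B.mul_rpow_eig_nonneg α hρ i) ht
    ⟨le_max_left _ _, max_le ht.le (min_le_right _ _)⟩

theorem repr_control (hρ : 0 ≤ ρ) (ht : 0 < t) (a : VDual Λ) {s : ℝ} (hs : s ∈ Icc 0 t) (i : ι) :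
    B.dualBasis.repr (B.control α ρ t a s) i =
      controlCoeff √(B.eig i) (ρ * B.eig i ^ α) t s * B.dualBasis.repr a i := by
  have hbound := B.abs_controlCoeff_eig_le α hρ ht s
  refine (repr_diagMul (by positivity) hbound a i).trans ?_
  rw [min_eq_left hs.2, max_eq_right hs.1]

theorem norm_control_le (hρ : 0 ≤ ρ) (ht : 0 < t) (a : VDual Λ) (s : ℝ) :
    ‖B.control α ρ t a s‖ ≤ 19 / t * ‖a‖ :=
  norm_diagMul_le (by positivity) (B.abs_controlCoeff_eig_le α hρ ht s) a

theorem continuous_control (hρ : 0 ≤ ρ) (ht : 0 < t) (a : VDual Λ) :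
    Continuous (B.control α ρ t a) :=
  continuous_diagMul (by positivity) (B.abs_controlCoeff_eig_le α hρ ht)
    (fun i => (continuous_controlCoeff (B.sqrt_eig_ne_zero i) _ t).comp
      (continuous_const.max (continuous_id.min continuous_const))) a

theorem lintegral_control_le (hρ : 0 ≤ ρ) (ht : 0 < t) (a : VDual Λ) :
    ∫⁻ s in Ioc 0 t, ‖B.control α ρ t a s‖ₑ ^ 2 ≤ ENNReal.ofReal (361 * ‖a‖ ^ 2 / t) :=
  calc ∫⁻ s in Ioc 0 t, ‖B.control α ρ t a s‖ₑ ^ 2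
      ≤ ∫⁻ _ in Ioc 0 t, ENNReal.ofReal ((19 / t * ‖a‖) ^ 2) := by
        refine lintegral_mono fun s => ?_
        rw [← ofReal_norm, ← ENNReal.ofReal_pow (norm_nonneg _)]
        gcongr
        exact B.norm_control_le α hρ ht a s
    _ = ENNReal.ofReal (361 * ‖a‖ ^ 2 / t) := by
        rw [setLIntegral_const, Real.volume_Ioc, ← ENNReal.ofReal_mul (by positivity)]
        congr 1
        field_simp
        ring

theorem exists_eq_eig {e : VDual Λ} {μ : ℝ} (he : e ≠ 0) (hμ : (e, μ • e) ∈ extGraph Λ) :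
    ∃ i, μ = B.eig i := by
  rw [B.extGraph_eq] at hμ
  obtain ⟨i, hi⟩ : ∃ i, B.dualBasis.repr e i ≠ 0 := by
    by_contra! h
    exact he (eq_of_repr_apply_eq B.dualBasis fun i => by simp [h i])
  refine ⟨i, mul_right_cancel₀ hi ?_⟩
  simpa using hμ i

variable {α}

theorem discriminant_eig_ne_zero
    (hρμ : ∀ (μ : ℝ) (x : Λ.op.domain), (x : U) ≠ 0 → Λ.op x = μ • (x : U) →
      ρ ^ 2 ≠ 4 * μ ^ (1 - 2 * α)) (i : ι) :
    ρ ^ 2 * B.eig i ^ (2 * α) - 4 * B.eig i ≠ 0 := by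
  have hne := hρμ (B.eig i) ⟨B.basis i, B.mem_domain i⟩ (B.basis.orthonormal.ne_zero i)
    (B.op_basis i)
  have hpow := Real.rpow_pos_of_pos (B.eig_pos i) (2 * α)
  rw [Real.rpow_sub (B.eig_pos i), Real.rpow_one] at hne
  contrapose! hne
  field_simp
  linarith

theorem isSpectralControl_control (hρ : 0 ≤ ρ) (ht : 0 < t)
    (hρμ : ∀ (μ : ℝ) (x : Λ.op.domain), (x : U) ≠ 0 → Λ.op x = μ • (x : U) →
      ρ ^ 2 ≠ 4 * μ ^ (1 - 2 * α)) (a : VDual Λ) :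
    IsSpectralControl Λ α ρ t a (B.control α ρ t a) := by
  intro s hs e μ he
  rcases eq_or_ne e 0 with rfl | he_ne
  · simp
  have hmul : (a, B.control α ρ t a s) ∈
      diagGraph B.dualBasis fun i => controlCoeff √(B.eig i) (ρ * B.eig i ^ α) t s :=
    B.repr_control α hρ ht a hs
  have hinner := inner_eq_mul_inner_of_mem_diagGraph
    (g := fun μ => controlCoeff √μ (ρ * μ ^ α) t s) hmul (B.extGraph_eq ▸ he)
  obtain ⟨i, rfl⟩ := B.exists_eq_eig he_ne he
  rw [coeffZero_add_deriv_coeffOne (B.eig_pos i) (B.discriminant_eig_ne_zero hρμ i), hinner,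
    Complex.ofReal_mul]

theorem steers_waveGraphT_control (hρ : 0 ≤ ρ) (ht : 0 < t) (T : ℝ) (a : VDual Λ) :
    Steers (waveGraphT Λ α ρ) (Gt Λ) T t (Gt Λ a) (B.control α ρ t a) := by
  rw [B.waveGraphT_eq]
  refine (steers_preimage_iff (pairIso B.dualBasis B.dualBasis).toContinuousLinearEquiv).2
    (steers_of_integral_flow_eq
      (fun i => isDissipative_blockOp √(B.eig i) (B.mul_rpow_eig_nonneg α hρ i))
      (closure_coordGraph B.eig α ρ) ht.le (B.continuous_control α hρ ht a) fun i => ?_)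
  set A := blockOp √(B.eig i) (ρ * B.eig i ^ α)
  calc ∫ r in (0 : ℝ)..t, flow A (t - r)
          (pairIso B.dualBasis B.dualBasis (Gt Λ (B.control α ρ t a r)) i)
      = ∫ r in (0 : ℝ)..t, B.dualBasis.repr a i •
          flow A (t - r) (controlCoeff √(B.eig i) (ρ * B.eig i ^ α) t r • Complex.I) := by
        refine intervalIntegral.integral_congr fun r hr => ?_
        rw [uIcc_of_le ht.le] at hr
        simp only [pairIso_dualBasis_Gt, B.repr_control α hρ ht a hr, map_smul, smul_smul,
          mul_comm]
    _ = -flow A t (pairIso B.dualBasis B.dualBasis (Gt Λ a) i) := by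
        rw [intervalIntegral.integral_smul,
          integral_flow_controlCoeff (B.sqrt_eig_ne_zero i) _ ht.ne', pairIso_dualBasis_Gt,
          map_smul, smul_neg]

end EigenBasis

end DampedWave

end

theorem mainTheorem8_general {U : Type*} [NormedAddCommGroup U] [InnerProductSpace ℝ U]
    [CompleteSpace U] (Λ : DampedWave.PosOp U) (hΛ : IsCompactOperator Λ.inv) (α : ℝ) {ρ : ℝ}
    (hρ : 0 ≤ ρ) :
    ∃ C : ℝ, 0 < C ∧ ∀ (a : DampedWave.VDual Λ) (T t : ℝ), 0 < t → t ≤ T →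
      DampedWave.controlEnergy (DampedWave.waveGraphT Λ α ρ) (DampedWave.Gt Λ) T t
          (DampedWave.Gt Λ a) ≤ ENNReal.ofReal (C * ‖a‖ ^ 2 / t) ∧
      DampedWave.controlEnergy (DampedWave.waveGraphT Λ α ρ) (DampedWave.Gt Λ) T t
          (DampedWave.Gt Λ a) =
        DampedWave.controlEnergy (DampedWave.waveGraph Λ α ρ) (DampedWave.G Λ) T t
          (DampedWave.G Λ a) ∧
      DampedWave.controlEnergy (DampedWave.waveGraph Λ α ρ) (DampedWave.G Λ) T t
          (DampedWave.G Λ a) ≤ ENNReal.ofReal (C * ‖a‖ ^ 2 / t) ∧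
      ∃ v : ℝ → DampedWave.VDual Λ,
        ((∀ (μ : ℝ) (x : Λ.op.domain), (x : U) ≠ 0 → Λ.op x = μ • (x : U) →
            ρ ^ 2 ≠ 4 * μ ^ (1 - 2 * α)) → DampedWave.IsSpectralControl Λ α ρ t a v) ∧
        DampedWave.Steers (DampedWave.waveGraphT Λ α ρ) (DampedWave.Gt Λ) T t
          (DampedWave.Gt Λ a) v ∧
        DampedWave.Steers (DampedWave.waveGraph Λ α ρ) (DampedWave.G Λ) T t
          (DampedWave.G Λ a) v ∧
        ∫⁻ s in Set.Ioc 0 t, ‖v s‖ₑ ^ 2 ≤ ENNReal.ofReal (C * ‖a‖ ^ 2 / t) := by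
  obtain ⟨ι, ⟨B⟩⟩ := DampedWave.exists_eigenBasis Λ hΛ
  refine ⟨361, by norm_num, fun a T t ht _ => ?_⟩
  have hsteers := B.steers_waveGraphT_control (α := α) hρ ht T a
  have hcost := B.lintegral_control_le α hρ ht a
  have henergyT : DampedWave.controlEnergy (DampedWave.waveGraphT Λ α ρ) (DampedWave.Gt Λ) T t
      (DampedWave.Gt Λ a) ≤ ENNReal.ofReal (361 * ‖a‖ ^ 2 / t) :=
    (iInf₂_le _ hsteers).trans hcost
  have henergy_eq := B.controlEnergy_waveGraphT_eq α ρ T t a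
  exact ⟨henergyT, henergy_eq, henergy_eq ▸ henergyT, B.control α ρ t a,
    fun hρμ => B.isSpectralControl_control hρ ht hρμ a, hsteers,
    B.steers_waveGraph_iff.2 hsteers, hcost⟩

theorem mainTheorem8 {U : Type*} [NormedAddCommGroup U] [InnerProductSpace ℝ U] [CompleteSpace U]
    [TopologicalSpace.SeparableSpace U]
    (Λ : DampedWave.PosOp U) (hΛ : DampedWave.IsTraceClass Λ.inv)
    (α ρ : ℝ) (hα : α ∈ Set.Ico (0 : ℝ) 1) (hρ : 0 < ρ)
    (hρμ : ∀ (μ : ℝ) (x : Λ.op.domain), (x : U) ≠ 0 → Λ.op x = μ • (x : U) →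
      ρ ^ 2 ≠ 4 * μ ^ (1 - 2 * α)) :
    ∃ C : ℝ, 0 < C ∧ ∀ (a : DampedWave.VDual Λ) (T t : ℝ), 0 < t → t ≤ T →
      DampedWave.controlEnergy (DampedWave.waveGraphT Λ α ρ) (DampedWave.Gt Λ) T t
          (DampedWave.Gt Λ a) ≤ ENNReal.ofReal (C * ‖a‖ ^ 2 / t) ∧
      DampedWave.controlEnergy (DampedWave.waveGraphT Λ α ρ) (DampedWave.Gt Λ) T t
          (DampedWave.Gt Λ a) =
        DampedWave.controlEnergy (DampedWave.waveGraph Λ α ρ) (DampedWave.G Λ) T t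
          (DampedWave.G Λ a) ∧
      DampedWave.controlEnergy (DampedWave.waveGraph Λ α ρ) (DampedWave.G Λ) T t
          (DampedWave.G Λ a) ≤ ENNReal.ofReal (C * ‖a‖ ^ 2 / t) ∧
      ∃ v : ℝ → DampedWave.VDual Λ, DampedWave.IsSpectralControl Λ α ρ t a v ∧
        DampedWave.Steers (DampedWave.waveGraphT Λ α ρ) (DampedWave.Gt Λ) T t
          (DampedWave.Gt Λ a) v ∧
        DampedWave.Steers (DampedWave.waveGraph Λ α ρ) (DampedWave.G Λ) T t
          (DampedWave.G Λ a) v ∧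
        ∫⁻ s in Set.Ioc 0 t, ‖v s‖ₑ ^ 2 ≤ ENNReal.ofReal (C * ‖a‖ ^ 2 / t) := by
  obtain ⟨C, hC, h⟩ := mainTheorem8_general Λ hΛ.isCompactOperator α hρ.le
  exact ⟨C, hC, fun a T t ht htT => by
    obtain ⟨hT, heq, hH, v, hv, hsteers⟩ := h a T t ht htT
    exact ⟨hT, heq, hH, v, hv hρμ, hsteers⟩⟩
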